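/- **Setting.** Fix a discount rate $r>0$, a total transition rate $\lambda>0$, a long-run average belief $\pi\in(0,1)$, a fixed cost $\kappa>0$, a continuous indirect utility $u:[0,1]\to\mathbb R$, and a convex function $c:[0,1]\to[0,\infty]$ that is finite and continuously differentiable on $(0,1)$. Beliefs are points of $[0,1]$; without new information a belief $p$ drifts to $p_t=e^{-\lambda t}p+(1-e^{-\lambda t})\pi$ after time $t$. An experiment at $p$ is a probability measure $F$ on $[0,1]$ with mean $p$ (write $F\in\mathcal B(p)$); it costs $C(F)+\kappa$, where $C(F)=\int (c(q)-c(p))\,dF(q)$ (equal to $0$ for the uninformative experiment). Write $\mathrm{Cav}\,g$ for the smallest concave function majorizing $g$, $\underline v(p)=\int_0^\infty e^{-rt}u(p_t)\,dt$ for the value of never acquiring information, and $\overline v(p)=\int_0^\infty e^{-rt}\,\mathrm{Cav}[u](p_t)\,dt$. The value function $v$ is the solution of the Bellman equation $$v(p)=\sup_{\tau\ge 0}\Big[\int_0^\tau e^{-rt}u(p_t)\,dt+e^{-r\tau}\Big(\sup_{F\in\mathcal B(p_\tau)}\int v\,dF-C(F)-\kappa\Big)\Big],\qquad p\in[0,1],$$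 among the bounded measurable functions on $[0,1]$ with $\underline v\le v\le\overline v$. Let $w=v-c$ on $\{c<\infty\}$, and let $\Delta=\mathrm{Cav}\,w-w$ on $\{c<\infty\}$ (concave envelope on that set), $\Delta=0$ elsewhere. Define the region of gross value of information $G=\{p\in[0,1]:\Delta(p)>0\}$ and the information acquisition region $I=\{p\in[0,1]:\Delta(p)=\kappa\}$. There is *gross value* at $p$ if $p\in G$, and *net value* if $p\in I$. The target beliefs at $p$ are the closest points $q^0(p)\le p\le q^1(p)$ of $[0,1]\setminus G$. **Optimal dynamics.** From a prior $p_0\in[0,1]$, beliefs drift, and information is acquired whenever the belief is in $I$, i.e. from a belief $p$ after the waiting time $\inf\{t\ge 0: p_t\in I\}$ (possibly $0$ or $\infty$). If information is acquired at $p$, the belief jumps to $q^0(p)$ with probability $\frac{q^1(p)-p}{q^1(p)-q^0(p)}$ and to $q^1(p)$ otherwise, the draws being independent across acquisitions. *Learning stops in finite time* if there is a finite $T$ such that no information is acquired after $T$. A (non-degenerate) *belief cycle* consists of $0\le q^0<p^0<\pi<p^1<q^1\le1$ and times $\tau^0,\tau^1>0$ with $q^i_{\tau^i}=p^i$; a prior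 *leads to a belief cycle* if there is a belief cycle such that almost surely, from some finite time on, all updates lead to $q^0$ or $q^1$ and each update to $q^i$ is followed by the next update after exactly the time $\tau^i$ (hence at the belief $p^i$). **Proposition.** Under optimal dynamics: (i) If for some prior learning stops in finite time with positive probability, then $\pi\notin I$, except possibly in the case of a tie in which never acquiring information is also optimal at $\pi$, i.e. $v(\pi)=\underline v(\pi)$. (ii) If $\pi\notin G$, then for every prior information is almost surely acquired at most a finite number of times. (iii) If $\pi\in G\setminus I$, then exactly one of the following holds: (a) for every prior, information is almost surely acquired at most a finite number of times; (b) there is an open interval $(\underline p,\overline p)$ with $0\le\underline p<\pi<\overline p\le1$ such that almost surely no information is ever acquired from any prior in $(\underline p,\overline p)$, while every prior in $[0,1]\setminus(\underline p,\overline p)$ leads to a belief cycle. Furthermore, if $\pi\in G\setminus I$, then (b) holds if and only if there are beliefs $a,b\in I$ with $a<\pi<b$ whose target beliefs are the same as those at $\pi$: $q^i(a)=q^i(\pi)=q^i(b)$ for $i=0,1$. -/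

import Mathlib

open Set MeasureTheory
open scoped ENNReal NNReal

noncomputable section

/-- Primitives of the information acquisition problem with a binary state. Beliefs (the probability
that the state is `1`) are the points of `[0,1]`; values of `u` and `c` outside `[0,1]` are never
used. -/
structure LearningModel where
  /-- discount rate -/
  r : ℝ
  /-- total transition rate of the state -/
  lam : ℝ
  /-- invariant distribution of the state (the long run average belief) -/
  piBar : ℝ
  /-- fixed cost of acquiring information -/
  kappa : ℝ
  /-- indirect utility -/
  u : ℝ → ℝ
  /-- certainty function that generates the uniformly posterior separable cost -/
  c : ℝ → ℝ≥0∞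
  r_pos : 0 < r
  lam_pos : 0 < lam
  piBar_mem : piBar ∈ Ioo (0 : ℝ) 1
  kappa_pos : 0 < kappa
  u_cont : ContinuousOn u (Icc 0 1)
  c_convex : ConvexOn ℝ≥0 (Icc (0 : ℝ) 1) c
  c_finite : ∀ p ∈ Ioo (0 : ℝ) 1, c p ≠ ∞
  c_contDiff : ContDiffOn ℝ 1 (fun p => (c p).toReal) (Ioo 0 1)

/-- The concave envelope of `g` on `S`: the pointwise smallest concave function on `S` that
majorizes `g` on `S`. -/
def concaveEnvelope (S : Set ℝ) (g : ℝ → ℝ) (p : ℝ) : ℝ :=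
  sInf {y | ∃ h : ℝ → ℝ, ConcaveOn ℝ S h ∧ (∀ x ∈ S, g x ≤ h x) ∧ y = h p}

/-- Distributions over posterior beliefs with mean `p`. -/
def BayesPlausible (p : ℝ) : Set (Measure ℝ) :=
  {F | IsProbabilityMeasure F ∧ F (Icc (0 : ℝ) 1)ᶜ = 0 ∧ ∫ q, q ∂F = p}

/-- The law of a sequence of independent uniform draws from `[0,1]`. -/
def uniformDraws : Measure (ℕ → unitInterval) :=
  Measure.infinitePi fun _ => (volume : Measure unitInterval)

namespace LearningModel

variable (M : LearningModel)

/-- The belief reached from `p` after a time `t` without new information. -/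
def drift (t p : ℝ) : ℝ :=
  Real.exp (-M.lam * t) * p + (1 - Real.exp (-M.lam * t)) * M.piBar

/-- The variable cost `C(F) = ∫ (c(q) - c(p)) dF(q)` where `p` is the mean of `F`. The difference
is taken in `[0,∞]`; it is never truncated, as `c` is convex. The convention `∞ - ∞ = 0` is used only
when `p` is an endpoint of `[0,1]`, where `F` is the uninformative experiment. -/
def infoCost (F : Measure ℝ) : ℝ≥0∞ :=
  (∫⁻ q, M.c q ∂F) - M.c (∫ q, q ∂F)

/-- `sup_{F ∈ B(p)} ∫ v dF - C(F)`; experiments of infinite cost never matter for this supremum. -/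
def infoValue (v : ℝ → ℝ) (p : ℝ) : ℝ :=
  sSup {x | ∃ F ∈ BayesPlausible p, M.infoCost F ≠ ∞ ∧ x = ∫ q, v q ∂F - (M.infoCost F).toReal}

/-- The Bellman operator: the value of the optimally timed next acquisition of information when
the continuation value is `v`. -/
def bellman (v : ℝ → ℝ) (p : ℝ) : ℝ :=
  sSup {x | ∃ τ : ℝ, 0 ≤ τ ∧
    x = (∫ t in (0 : ℝ)..τ, Real.exp (-M.r * t) * M.u (M.drift t p)) +
      Real.exp (-M.r * τ) * (M.infoValue v (M.drift τ p) - M.kappa)}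

/-- The value of never acquiring information. -/
def lowerValue (p : ℝ) : ℝ :=
  ∫ t in Ioi (0 : ℝ), Real.exp (-M.r * t) * M.u (M.drift t p)

/-- The upper bound on values. If `u` is convex, this is the value of costless perfect observation
of the state. -/
def upperValue (p : ℝ) : ℝ :=
  ∫ t in Ioi (0 : ℝ), Real.exp (-M.r * t) * concaveEnvelope (Icc 0 1) M.u (M.drift t p)

/-- The candidate value functions. -/
def Candidate (v : ℝ → ℝ) : Prop :=
  Measurable (fun p : Icc (0 : ℝ) 1 => v p) ∧
  (∃ K : ℝ, ∀ p ∈ Icc (0 : ℝ) 1, |v p| ≤ K) ∧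
  ∀ p ∈ Icc (0 : ℝ) 1, M.lowerValue p ≤ v p ∧ v p ≤ M.upperValue p

/-- `v` is the value function: the fixed point of the Bellman operator among the candidate value
functions. -/
def IsValueFunction (v : ℝ → ℝ) : Prop :=
  M.Candidate v ∧ ∀ p ∈ Icc (0 : ℝ) 1, M.bellman v p = v p

/-- The beliefs with finite certainty; this is `[0,1]`, possibly without some of its endpoints. -/
def costDomain : Set ℝ := {p | p ∈ Icc (0 : ℝ) 1 ∧ M.c p ≠ ∞}

/-- The net value function `w = v - c`. -/
def netValue (v : ℝ → ℝ) (p : ℝ) : ℝ := v p - (M.c p).toReal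

open Classical in
/-- The residual value of information `Cav w - w`. It is `0` at an endpoint of `[0,1]` at which
`c` is infinite: only the uninformative experiment is feasible there. -/
def residualValue (v : ℝ → ℝ) (p : ℝ) : ℝ :=
  if p ∈ M.costDomain then
    concaveEnvelope M.costDomain (M.netValue v) p - M.netValue v p
  else 0

/-- The beliefs with gross value of information. -/
def grossRegion (v : ℝ → ℝ) : Set ℝ := {p | p ∈ Icc (0 : ℝ) 1 ∧ 0 < M.residualValue v p}

/-- The information acquisition region. -/
def infoRegion (v : ℝ → ℝ) : Set ℝ := {p | p ∈ Icc (0 : ℝ) 1 ∧ M.residualValue v p = M.kappa}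

/-- The closest belief weakly below `p` without gross value of information. -/
def lowerTarget (v : ℝ → ℝ) (p : ℝ) : ℝ := sSup {q | q ∈ Icc (0 : ℝ) 1 \ M.grossRegion v ∧ q ≤ p}

/-- The closest belief weakly above `p` without gross value of information. -/
def upperTarget (v : ℝ → ℝ) (p : ℝ) : ℝ := sInf {q | q ∈ Icc (0 : ℝ) 1 \ M.grossRegion v ∧ p ≤ q}

/-- The optimal waiting time `inf {t ≥ 0 | p_t ∈ infoRegion}`, which is `∞` if there is no such `t`. -/
def waitTime (v : ℝ → ℝ) (p : ℝ) : ℝ≥0∞ :=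
  sInf {d | ∃ t : ℝ, 0 ≤ t ∧ M.drift t p ∈ M.infoRegion v ∧ d = ENNReal.ofReal t}

open Classical in
/-- The posterior drawn by the optimal binary experiment at `p`, as a function of a uniform draw `s`:
the lower target `q⁰` has probability `(q¹ - p) / (q¹ - q⁰)`, the upper target `q¹` the rest. -/
def posterior (v : ℝ → ℝ) (p s : ℝ) : ℝ :=
  if s * (M.upperTarget v p - M.lowerTarget v p) ≤ M.upperTarget v p - p then
    M.lowerTarget v p
  else M.upperTarget v p

open Classical in
/-- The time of the `n`-th acquisition of information, and the belief just after it, under the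
optimal policy from the prior `p₀`. For `n = 0` this is the initial time with the prior. If
information is acquired fewer than `n` times, the time is `∞` (and the belief is the last one). -/
def state (v : ℝ → ℝ) (p₀ : ℝ) (ω : ℕ → unitInterval) : ℕ → ℝ≥0∞ × ℝ
  | 0 => (0, p₀)
  | n + 1 =>
    ((state v p₀ ω n).1 + M.waitTime v (state v p₀ ω n).2,
      if M.waitTime v (state v p₀ ω n).2 = ∞ then (state v p₀ ω n).2
      else M.posterior v
        (M.drift (M.waitTime v (state v p₀ ω n).2).toReal (state v p₀ ω n).2) (ω n))

/-- The time of the `n`-th acquisition of information (`n ≥ 1`); time `0` for `n = 0`. -/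
def acqTime (v : ℝ → ℝ) (p₀ : ℝ) (ω : ℕ → unitInterval) (n : ℕ) : ℝ≥0∞ := (M.state v p₀ ω n).1

/-- The belief just after the `n`-th acquisition of information. Until the next one, beliefs follow
`drift`. -/
def updatedBelief (v : ℝ → ℝ) (p₀ : ℝ) (ω : ℕ → unitInterval) (n : ℕ) : ℝ := (M.state v p₀ ω n).2

/-- After some finite time, no information is acquired. -/
def LearningStops (v : ℝ → ℝ) (p₀ : ℝ) (ω : ℕ → unitInterval) : Prop :=
  ∃ T : ℝ≥0, ∀ n, 1 ≤ n → M.acqTime v p₀ ω n ≤ T ∨ M.acqTime v p₀ ω n = ∞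

/-- Information is acquired at most a finite number of times. -/
def FinitelyOften (v : ℝ → ℝ) (p₀ : ℝ) (ω : ℕ → unitInterval) : Prop :=
  {n | 1 ≤ n ∧ M.acqTime v p₀ ω n ≠ ∞}.Finite

/-- No information is ever acquired. -/
def NeverAcquires (v : ℝ → ℝ) (p₀ : ℝ) (ω : ℕ → unitInterval) : Prop :=
  ∀ n, 1 ≤ n → M.acqTime v p₀ ω n = ∞

/-- A non-degenerate belief cycle: target beliefs `q⁰, q¹`, threshold beliefs `p⁰, p¹`, and the
times `τ⁰, τ¹` that beliefs take to drift from each target to its threshold. -/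
structure BeliefCycle where
  q₀ : ℝ
  q₁ : ℝ
  p₀ : ℝ
  p₁ : ℝ
  τ₀ : ℝ
  τ₁ : ℝ
  q₀_nonneg : 0 ≤ q₀
  q₀_lt : q₀ < p₀
  p₀_lt : p₀ < M.piBar
  lt_p₁ : M.piBar < p₁
  lt_q₁ : p₁ < q₁
  q₁_le_one : q₁ ≤ 1
  τ₀_pos : 0 < τ₀
  τ₁_pos : 0 < τ₁
  drift₀ : M.drift τ₀ q₀ = p₀
  drift₁ : M.drift τ₁ q₁ = p₁

/-- From some finite time on, beliefs follow the cycle `B`: after an update to the target `qⁱ` the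
next update occurs when the time `τⁱ` has passed (hence at the threshold `pⁱ`), and every update
leads to one of the two targets. -/
def EventuallyFollows (v : ℝ → ℝ) (p₀ : ℝ) (ω : ℕ → unitInterval) (B : M.BeliefCycle) : Prop :=
  ∃ N, M.acqTime v p₀ ω N ≠ ∞ ∧ ∀ n, N ≤ n →
    (M.updatedBelief v p₀ ω n = B.q₀ ∧
      M.acqTime v p₀ ω (n + 1) = M.acqTime v p₀ ω n + ENNReal.ofReal B.τ₀) ∨
    (M.updatedBelief v p₀ ω n = B.q₁ ∧
      M.acqTime v p₀ ω (n + 1) = M.acqTime v p₀ ω n + ENNReal.ofReal B.τ₁)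

/-- Almost surely, information is acquired at most a finite number of times, for all priors. -/
def FiniteForAllPriors (v : ℝ → ℝ) : Prop :=
  ∀ p₀ ∈ Icc (0 : ℝ) 1, ∀ᵐ ω ∂uniformDraws, M.FinitelyOften v p₀ ω

/-- There is a trap: an open interval around the long run average belief such that no information
is ever acquired from priors in it, and all other priors lead to a belief cycle. -/
def HasTrap (v : ℝ → ℝ) : Prop :=
  ∃ a b : ℝ, 0 ≤ a ∧ a < M.piBar ∧ M.piBar < b ∧ b ≤ 1 ∧
    (∀ p₀ ∈ Ioo a b, ∀ᵐ ω ∂uniformDraws, M.NeverAcquires v p₀ ω) ∧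
    ∀ p₀ ∈ Icc (0 : ℝ) 1 \ Ioo a b, ∃ B : M.BeliefCycle,
      ∀ᵐ ω ∂uniformDraws, M.EventuallyFollows v p₀ ω B

end LearningModel

end

/-! ### Patterns in independent draws -/

noncomputable section

/-! The analytic half shows that the value function `v` and the residual value Δ are continuous on
the whole of [0,1]. Mixing experiments shows that `infoValue` minus `c` is concave, and supporting
lines identify it with the concave envelope of the net value, so that `infoValue` = v + Δ
(`Candidate.infoValue_eq`). Since immediate acquisition is feasible, Δ ≤ κ. Continuity makes the
acquisition region I and the set of targets {Δ = 0} closed, and Δ = κ on the one against Δ = 0 on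
the other puts a distance d > 0 between them (`exists_separation`).

This gap drives the dynamics. Each target is drawn with probability at least d, a draw of the target
on the far side moves the belief by at least d, and after the first acquisition waiting times are at
least d/λ because drift has speed at most λ. Hence acquisition times cannot accumulate, and learning
stops only at a belief whose drift path misses I. Along such a path v equals the value of never
acquiring, and the limit at π gives (i).

For (ii) and (iii), as long as beliefs remain on one side of π, drift and favourable draws push in
the same direction. More than 1/d favourable draws in a row are impossible inside [0,1], yet almost
surely occur; so the process reaches any set that it can avoid only while staying on that side
(`ae_exists_mem`). If π is a target, neither side can be left. If π has gross but no net value, let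
q⁰ < π < q¹ be its targets. Without acquisition beliefs in (q⁰,π), or without any in (π,q¹),
crossing π leads to a target where learning ends. With acquisition beliefs in both, the nearest ones
to π bound the trap, and outside it the process reaches q⁰ or q¹ and then cycles between them.
Conversely, a low draw followed by a high draw along a cycle reveals acquisition beliefs on both
sides of π with the targets of π. -/

instance isProbabilityMeasure_uniformDraws : IsProbabilityMeasure uniformDraws := by
  unfold uniformDraws; infer_instance

/-- Almost surely, a finite pattern of events of positive probability occurs infinitely often in
consecutive draws. -/
theorem ae_frequently_pattern (N : ℕ) (E : ℕ → Set unitInterval)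
    (hE : ∀ i, MeasurableSet (E i)) (hpos : ∀ i, volume (E i) ≠ 0) :
    ∀ᵐ ω ∂uniformDraws, ∀ m, ∃ n, m ≤ n ∧ ∀ i < N, ω (n + i) ∈ E i := by
  rcases Nat.eq_zero_or_pos N with rfl | hN
  · exact Filter.Eventually.of_forall fun ω m => ⟨m, le_rfl, by simp⟩
  -- `B k` is the k-th block of N consecutive indices and `A k` the event that the pattern occurs
  -- there. Disjoint blocks are independent and the events have equal positive probability, so the
  -- second Borel–Cantelli lemma applies.
  let B : ℕ → Finset ℕ := fun k => (Finset.range N).image (fun i => k * N + i)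
  let A : ℕ → Set (ℕ → unitInterval) := fun k => Set.pi (B k) (fun n => E (n % N))
  have hA (k) : MeasurableSet (A k) :=
    MeasurableSet.pi (Finset.countable_toSet _) fun n _ => hE _
  have hBdiv {k n} (h : n ∈ B k) : n / N = k := by
    simp only [B, Finset.mem_image, Finset.mem_range] at h
    obtain ⟨i, hi, rfl⟩ := h
    rw [Nat.mul_comm, Nat.mul_add_div hN, Nat.div_eq_of_lt hi, add_zero]
  have hdisj (s : Set ℕ) : s.PairwiseDisjoint B := by
    intro k _ l _ hkl
    rw [Function.onFun, Finset.disjoint_left]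
    intro n hk hl
    exact hkl ((hBdiv hk).symm.trans (hBdiv hl))
  have hprob (k) : uniformDraws (A k) = ∏ i ∈ Finset.range N, volume (E i) := by
    simp only [A, uniformDraws]
    rw [Measure.infinitePi_pi _ (fun i _ => hE _),
      Finset.prod_image (by intro a _ b _ h; simpa using h)]
    refine Finset.prod_congr rfl fun i hi => ?_
    rw [Nat.mul_comm, Nat.mul_add_mod, Nat.mod_eq_of_lt (Finset.mem_range.1 hi)]
  have hindep : ProbabilityTheory.iIndepSet A uniformDraws := by
    rw [ProbabilityTheory.iIndepSet_iff_meas_biInter hA]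
    intro s
    have : ⋂ i ∈ s, A i = Set.pi (s.biUnion B) (fun n => E (n % N)) := by
      ext ω
      simp only [A, mem_iInter, Set.mem_pi, Finset.mem_coe, Finset.mem_biUnion]
      exact ⟨fun h n ⟨k, hk, hn⟩ => h k hk n hn, fun h k hk n hn => h n ⟨k, hk, hn⟩⟩
    rw [this]
    simp only [A, uniformDraws]
    rw [Measure.infinitePi_pi _ (fun i _ => hE _), Finset.prod_biUnion (hdisj _)]
    refine Finset.prod_congr rfl fun k _ => ?_
    rw [Measure.infinitePi_pi _ (fun i _ => hE _)]
  have hsum : ∑' n, uniformDraws (A n) = ∞ := by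
    simp_rw [hprob]
    exact ENNReal.tsum_const_eq_top_of_ne_zero (Finset.prod_ne_zero_iff.2 fun i _ => hpos i)
  have hlim := ProbabilityTheory.measure_limsup_eq_one hA hindep hsum
  have hmeas : MeasurableSet (Filter.limsup A Filter.atTop) := MeasurableSet.measurableSet_limsup hA
  have hae := (prob_compl_eq_zero_iff hmeas).2 hlim
  rw [← mem_ae_iff] at hae
  filter_upwards [hae] with ω hω m
  rw [Filter.mem_limsup_iff_frequently_mem, Filter.frequently_atTop] at hω
  obtain ⟨k, hk, hkA⟩ := hω m
  refine ⟨k * N, hk.trans (Nat.le_mul_of_pos_right k hN), fun i hi => ?_⟩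
  have := hkA (k * N + i) (by simp only [B, Finset.coe_image, Finset.coe_range]; exact ⟨i, hi, rfl⟩)
  simpa only [Nat.mul_comm k, Nat.mul_add_mod, Nat.mod_eq_of_lt hi] using this

theorem volume_unitInterval_lt_ne_zero {d : ℝ} (hd : 0 < d) (hd1 : d ≤ 1) :
    volume {s : unitInterval | (s : ℝ) < d} ≠ 0 := by
  have := unitInterval.volume_Iio (x := ⟨d, hd.le, hd1⟩)
  rw [show {s : unitInterval | (s : ℝ) < d} = Iio ⟨d, hd.le, hd1⟩ from rfl, this]
  simpa using hd

theorem volume_unitInterval_gt_ne_zero {d : ℝ} (hd : 0 ≤ d) (hd1 : d < 1) :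
    volume {s : unitInterval | d < (s : ℝ)} ≠ 0 := by
  have := unitInterval.volume_Ioi (x := ⟨d, hd, hd1.le⟩)
  rw [show {s : unitInterval | d < (s : ℝ)} = Ioi ⟨d, hd, hd1.le⟩ from rfl, this]
  simpa using hd1

/-! ### Drift of beliefs towards the long run average -/

namespace LearningModel

variable (M : LearningModel)

theorem drift_zero (p : ℝ) : M.drift 0 p = p := by simp [drift]

theorem drift_drift (s t p : ℝ) : M.drift s (M.drift t p) = M.drift (t + s) p := by
  have : Real.exp (-M.lam * (t + s)) = Real.exp (-M.lam * t) * Real.exp (-M.lam * s) := by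
    rw [← Real.exp_add]; ring_nf
  simp only [drift, this]; ring

theorem drift_sub_piBar (t p : ℝ) :
    M.drift t p - M.piBar = Real.exp (-M.lam * t) * (p - M.piBar) := by
  simp only [drift]; ring

theorem exp_neg_lam_le_one {t : ℝ} (ht : 0 ≤ t) : Real.exp (-M.lam * t) ≤ 1 :=
  Real.exp_le_one_iff.2 (by nlinarith [M.lam_pos])

theorem drift_mem_Icc {a b t p : ℝ} (ha : a ≤ M.piBar) (hb : M.piBar ≤ b) (ht : 0 ≤ t)
    (hp : p ∈ Icc a b) : M.drift t p ∈ Icc a b := by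
  have h0 := Real.exp_pos (-M.lam * t)
  have h1 := M.exp_neg_lam_le_one ht
  simp only [drift, mem_Icc] at *
  constructor <;> nlinarith

theorem drift_mem_unit {t p : ℝ} (ht : 0 ≤ t) (hp : p ∈ Icc (0 : ℝ) 1) :
    M.drift t p ∈ Icc (0 : ℝ) 1 :=
  M.drift_mem_Icc M.piBar_mem.1.le M.piBar_mem.2.le ht hp

theorem le_drift {t p : ℝ} (ht : 0 ≤ t) (hp : p ≤ M.piBar) : p ≤ M.drift t p := by
  have := M.exp_neg_lam_le_one ht
  have := M.drift_sub_piBar t p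
  nlinarith

theorem drift_le {t p : ℝ} (ht : 0 ≤ t) (hp : M.piBar ≤ p) : M.drift t p ≤ p := by
  have := M.exp_neg_lam_le_one ht
  have := M.drift_sub_piBar t p
  nlinarith

theorem drift_le_piBar {t p : ℝ} (hp : p ≤ M.piBar) : M.drift t p ≤ M.piBar := by
  have := Real.exp_pos (-M.lam * t)
  have := M.drift_sub_piBar t p
  nlinarith

theorem piBar_le_drift {t p : ℝ} (hp : M.piBar ≤ p) : M.piBar ≤ M.drift t p := by
  have := Real.exp_pos (-M.lam * t)
  have := M.drift_sub_piBar t p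
  nlinarith

theorem drift_lt_piBar {t p : ℝ} (hp : p < M.piBar) : M.drift t p < M.piBar := by
  have := Real.exp_pos (-M.lam * t)
  have := M.drift_sub_piBar t p
  nlinarith

theorem piBar_lt_drift {t p : ℝ} (hp : M.piBar < p) : M.piBar < M.drift t p := by
  have := Real.exp_pos (-M.lam * t)
  have := M.drift_sub_piBar t p
  nlinarith

theorem continuous_drift_time (p : ℝ) : Continuous fun t => M.drift t p := by
  unfold drift; fun_prop

theorem tendsto_drift (p : ℝ) :
    Filter.Tendsto (fun t => M.drift t p) Filter.atTop (nhds M.piBar) := by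
  have h : Filter.Tendsto (fun t : ℝ => Real.exp (-M.lam * t)) Filter.atTop (nhds 0) :=
    Real.tendsto_exp_atBot.comp
      (Filter.tendsto_id.const_mul_atTop_of_neg (by linarith [M.lam_pos]))
  simpa [drift] using
    (h.mul_const p).add (((tendsto_const_nhds (x := (1 : ℝ))).sub h).mul_const M.piBar)

theorem abs_drift_sub_drift_le {t p q : ℝ} (ht : 0 ≤ t) :
    |M.drift t p - M.drift t q| ≤ |p - q| := by
  have : M.drift t p - M.drift t q = Real.exp (-M.lam * t) * (p - q) := by simp only [drift]; ring
  rw [this, abs_mul, abs_of_pos (Real.exp_pos _)]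
  exact mul_le_of_le_one_left (abs_nonneg _) (M.exp_neg_lam_le_one ht)

theorem abs_drift_sub_le {t p : ℝ} (ht : 0 ≤ t) (hp : p ∈ Icc (0 : ℝ) 1) :
    |M.drift t p - p| ≤ M.lam * t := by
  have h1 := M.exp_neg_lam_le_one ht
  have h2 : 1 - Real.exp (-M.lam * t) ≤ M.lam * t := by
    linarith [Real.add_one_le_exp (-M.lam * t)]
  have : M.drift t p - p = (1 - Real.exp (-M.lam * t)) * (M.piBar - p) := by
    simp only [drift]; ring
  rw [this, abs_mul, abs_of_nonneg (by linarith)]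
  have h3 : |M.piBar - p| ≤ 1 := by
    obtain ⟨_, _⟩ := M.piBar_mem
    rw [abs_le]; constructor <;> linarith [hp.1, hp.2]
  nlinarith [abs_nonneg (M.piBar - p)]

/-- The time that beliefs take to drift from `p` to `q`. -/
def travelTime (p q : ℝ) : ℝ := -Real.log ((q - M.piBar) / (p - M.piBar)) / M.lam

theorem drift_travelTime {p q : ℝ} (h : 0 < (q - M.piBar) / (p - M.piBar)) :
    M.drift (M.travelTime p q) p = q := by
  have hp : p - M.piBar ≠ 0 := by rintro h0; simp [h0] at h
  have : -M.lam * M.travelTime p q = Real.log ((q - M.piBar) / (p - M.piBar)) := by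
    unfold travelTime; field_simp [M.lam_pos.ne']
  rw [← sub_left_inj (a := M.piBar), drift_sub_piBar, this, Real.exp_log h, div_mul_cancel₀ _ hp]

theorem travelTime_nonneg {p q : ℝ} (h : 0 < (q - M.piBar) / (p - M.piBar))
    (h1 : (q - M.piBar) / (p - M.piBar) ≤ 1) : 0 ≤ M.travelTime p q :=
  div_nonneg (neg_nonneg.2 (Real.log_nonpos h.le h1)) M.lam_pos.le

theorem exists_drift_eq_of_le {p q : ℝ} (hpq : p ≤ q) (hq : q < M.piBar) :
    ∃ t, 0 ≤ t ∧ M.drift t p = q := by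
  have h : 0 < (q - M.piBar) / (p - M.piBar) := div_pos_of_neg_of_neg (by linarith) (by linarith)
  refine ⟨_, M.travelTime_nonneg h ?_, M.drift_travelTime h⟩
  rw [div_le_one_of_neg (by linarith)]; linarith

theorem exists_drift_eq_of_ge {p q : ℝ} (hpq : q ≤ p) (hq : M.piBar < q) :
    ∃ t, 0 ≤ t ∧ M.drift t p = q := by
  have h : 0 < (q - M.piBar) / (p - M.piBar) := div_pos (by linarith) (by linarith)
  refine ⟨_, M.travelTime_nonneg h ?_, M.drift_travelTime h⟩
  rw [div_le_one (by linarith)]; linarith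

end LearningModel

end

/-! ### Experiments and the gross value of information -/

noncomputable section

/-- The right derivative at an interior point is a subgradient: it is at most every slope to the
right and at least every slope to the left. -/
theorem ConvexOn.exists_forall_add_mul_le {S : Set ℝ} {f : ℝ → ℝ} (hf : ConvexOn ℝ S f) {x : ℝ}
    (hx : x ∈ interior S) : ∃ m, ∀ y ∈ S, f x + m * (y - x) ≤ f y := by
  refine ⟨derivWithin f (Ioi x) x, fun y hy => ?_⟩
  rcases lt_trichotomy x y with h | rfl | h
  · have := hf.rightDeriv_le_slope_of_mem_interior hx hy h
    rw [slope_def_field, le_div_iff₀ (by linarith)] at this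
    linarith
  · simp
  · have h1 := hf.slope_le_leftDeriv_of_mem_interior hy hx h
    have h2 := hf.leftDeriv_le_rightDeriv_of_mem_interior hx
    have := h1.trans h2
    rw [slope_def_field, div_le_iff₀ (by linarith)] at this
    linarith

/-- Only the positive part of `f` has to be dominated. Since `g` need not be measurable, affine
functions can be compared with the [0,∞]-valued `c` under any experiment. -/
theorem integral_le_toReal_lintegral {α : Type*} [MeasurableSpace α] {μ : Measure α} {f : α → ℝ}
    {g : α → ℝ≥0∞} (hf : Integrable f μ) (hfg : ∀ᵐ x ∂μ, ENNReal.ofReal (f x) ≤ g x)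
    (hg : ∫⁻ x, g x ∂μ ≠ ∞) : ∫ x, f x ∂μ ≤ (∫⁻ x, g x ∂μ).toReal := by
  rw [integral_eq_lintegral_pos_part_sub_lintegral_neg_part hf]
  have := ENNReal.toReal_mono hg (lintegral_mono_ae hfg)
  linarith [ENNReal.toReal_nonneg (a := ∫⁻ x, ENNReal.ofReal (-f x) ∂μ)]

namespace BayesPlausible

variable {p : ℝ} {F : Measure ℝ}

theorem ae_mem (hF : F ∈ BayesPlausible p) : ∀ᵐ q ∂F, q ∈ Icc (0 : ℝ) 1 := mem_ae_iff.2 hF.2.1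

theorem integrable_of_bounded (hF : F ∈ BayesPlausible p) {f : ℝ → ℝ}
    (hm : Measurable fun q : Icc (0 : ℝ) 1 => f q) {K : ℝ} (hK : ∀ q ∈ Icc (0 : ℝ) 1, |f q| ≤ K) :
    Integrable f F := by
  have := hF.1
  have hind : Measurable ((Icc (0 : ℝ) 1).indicator f) := by
    refine measurable_of_restrict_of_restrict_compl (s := Icc (0 : ℝ) 1) measurableSet_Icc ?_ ?_
    · convert hm using 1
      ext q
      exact Set.indicator_of_mem q.2 f
    · convert measurable_const (a := (0 : ℝ)) using 1
      ext q
      exact Set.indicator_of_notMem q.2 f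
  have hae : f =ᵐ[F] (Icc (0 : ℝ) 1).indicator f := by
    filter_upwards [ae_mem hF] with q hq
    rw [Set.indicator_of_mem hq]
  refine Integrable.of_bound (hind.aestronglyMeasurable.congr hae.symm) K ?_
  filter_upwards [ae_mem hF] with q hq using hK q hq

theorem integrable_id (hF : F ∈ BayesPlausible p) : Integrable (fun q : ℝ => q) F :=
  integrable_of_bounded hF measurable_subtype_coe (K := 1) fun q hq => by
    rw [abs_of_nonneg hq.1]; exact hq.2

theorem integrable_affine (hF : F ∈ BayesPlausible p) (a m : ℝ) :
    Integrable (fun q : ℝ => a + m * (q - p)) F := by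
  have := hF.1
  exact (integrable_const a).add (((integrable_id hF).sub (integrable_const p)).const_mul m)

theorem integral_affine (hF : F ∈ BayesPlausible p) (a m : ℝ) :
    ∫ q, (a + m * (q - p)) ∂F = a := by
  have := hF.1
  have h := (integrable_id hF).sub (integrable_const p)
  have h0 : ∫ q : ℝ, (q - p) ∂F = 0 := by
    rw [integral_sub (integrable_id hF) (integrable_const p), hF.2.2]; simp
  rw [integral_add (integrable_const a)
    (show Integrable (fun q => m * (q - p)) F from h.const_mul m),
    integral_const_mul, h0]
  simp

theorem dirac_mem (hp : p ∈ Icc (0 : ℝ) 1) : Measure.dirac p ∈ BayesPlausible p :=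
  ⟨inferInstance, by rw [Measure.dirac_apply' _ measurableSet_Icc.compl]; simpa using hp,
    by simp⟩

theorem mix (x y : ℝ) {F₁ F₂ : Measure ℝ} (h₁ : F₁ ∈ BayesPlausible x) (h₂ : F₂ ∈ BayesPlausible y)
    {a b : ℝ≥0} (hab : a + b = 1) : a • F₁ + b • F₂ ∈ BayesPlausible (a * x + b * y) := by
  have := h₁.1
  have := h₂.1
  refine ⟨⟨?_⟩, ?_, ?_⟩
  · simp only [Measure.add_apply, Measure.smul_apply, measure_univ, ENNReal.smul_def,
      smul_eq_mul, mul_one]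
    exact_mod_cast hab
  · simp [h₁.2.1, h₂.2.1]
  · rw [integral_add_measure ((integrable_id h₁).smul_measure_nnreal)
      ((integrable_id h₂).smul_measure_nnreal), integral_smul_nnreal_measure,
      integral_smul_nnreal_measure, h₁.2.2, h₂.2.2]
    simp [NNReal.smul_def]

/-- The only distribution with mean at an endpoint of `[0,1]` is degenerate. -/
theorem ae_eq_of_endpoint (hF : F ∈ BayesPlausible p) (hp : p = 0 ∨ p = 1) : ∀ᵐ q ∂F, q = p := by
  have := hF.1
  have key (g : ℝ → ℝ) (hg : ∀ q ∈ Icc (0 : ℝ) 1, 0 ≤ g q) (hgi : Integrable g F)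
      (h0 : ∫ q, g q ∂F = 0) : ∀ᵐ q ∂F, g q = 0 :=
    (integral_eq_zero_iff_of_nonneg_ae (by filter_upwards [ae_mem hF] with q hq using hg q hq)
      hgi).1 h0
  rcases hp with rfl | rfl
  · exact key _ (fun q hq => hq.1) (integrable_id hF) hF.2.2
  · have := key (fun q => 1 - q) (fun q hq => by linarith [hq.2])
      ((integrable_const 1).sub (integrable_id hF))
      (by rw [integral_sub (integrable_const 1) (integrable_id hF), hF.2.2]; simp)
    filter_upwards [this] with q hq
    linarith

end BayesPlausible

namespace LearningModel

variable (M : LearningModel)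

theorem Ioo_subset_costDomain : Ioo (0 : ℝ) 1 ⊆ M.costDomain :=
  fun p hp => ⟨Ioo_subset_Icc_self hp, M.c_finite p hp⟩

theorem c_convex_apply {x y : ℝ} (hx : x ∈ Icc (0 : ℝ) 1) (hy : y ∈ Icc (0 : ℝ) 1) {a b : ℝ}
    (ha : 0 ≤ a) (hb : 0 ≤ b) (hab : a + b = 1) :
    M.c (a * x + b * y) ≤ ENNReal.ofReal a * M.c x + ENNReal.ofReal b * M.c y := by
  have := M.c_convex.2 hx hy (zero_le (a := a.toNNReal)) (zero_le (a := b.toNNReal))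
    (by rw [← Real.toNNReal_add ha hb, hab, Real.toNNReal_one])
  simpa [NNReal.smul_def, ENNReal.smul_def, Real.coe_toNNReal _ ha, Real.coe_toNNReal _ hb,
    ENNReal.ofReal] using this

theorem convexOn_c_toReal : ConvexOn ℝ M.costDomain fun p => (M.c p).toReal := by
  have key {x y : ℝ} (hx : x ∈ M.costDomain) (hy : y ∈ M.costDomain) (a b : ℝ) :
      ENNReal.ofReal a * M.c x + ENNReal.ofReal b * M.c y ≠ ∞ :=
    ENNReal.add_ne_top.2 ⟨ENNReal.mul_ne_top ENNReal.ofReal_ne_top hx.2,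
      ENNReal.mul_ne_top ENNReal.ofReal_ne_top hy.2⟩
  refine ⟨fun x hx y hy a b ha hb hab => ⟨convex_Icc 0 1 hx.1 hy.1 ha hb hab, ?_⟩,
    fun x hx y hy a b ha hb hab => ?_⟩
  · exact ne_top_of_le_ne_top (key hx hy a b) (M.c_convex_apply hx.1 hy.1 ha hb hab)
  · have := ENNReal.toReal_mono (key hx hy a b) (M.c_convex_apply hx.1 hy.1 ha hb hab)
    rw [ENNReal.toReal_add (ENNReal.mul_ne_top ENNReal.ofReal_ne_top hx.2)
      (ENNReal.mul_ne_top ENNReal.ofReal_ne_top hy.2), ENNReal.toReal_mul, ENNReal.toReal_mul,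
      ENNReal.toReal_ofReal ha, ENNReal.toReal_ofReal hb] at this
    simpa using this

theorem mem_interior_costDomain {p : ℝ} (hp : p ∈ Ioo (0 : ℝ) 1) : p ∈ interior M.costDomain :=
  interior_mono M.Ioo_subset_costDomain (by rwa [isOpen_Ioo.interior_eq])

/-- Jensen's inequality for the certainty function. -/
theorem c_toReal_le_lintegral {p : ℝ} (hp : p ∈ Ioo (0 : ℝ) 1) {F : Measure ℝ}
    (hF : F ∈ BayesPlausible p) (hfin : ∫⁻ q, M.c q ∂F ≠ ∞) :
    (M.c p).toReal ≤ (∫⁻ q, M.c q ∂F).toReal := by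
  obtain ⟨m, hm⟩ := M.convexOn_c_toReal.exists_forall_add_mul_le (M.mem_interior_costDomain hp)
  rw [← BayesPlausible.integral_affine hF (M.c p).toReal m]
  refine integral_le_toReal_lintegral (BayesPlausible.integrable_affine hF _ m) ?_ hfin
  filter_upwards [BayesPlausible.ae_mem hF] with q hq
  by_cases hc : M.c q = ∞
  · rw [hc]; exact le_top
  · exact (ENNReal.ofReal_le_iff_le_toReal hc).2 (hm q ⟨hq, hc⟩)

theorem infoCost_dirac (p : ℝ) : M.infoCost (Measure.dirac p) = 0 := by
  simp [infoCost]

variable {M} {v : ℝ → ℝ}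

theorem Candidate.integrable (hv : M.Candidate v) {p : ℝ} {F : Measure ℝ}
    (hF : F ∈ BayesPlausible p) : Integrable v F := by
  obtain ⟨hm, ⟨K, hK⟩, -⟩ := hv
  exact BayesPlausible.integrable_of_bounded hF hm hK

theorem Candidate.bddAbove_infoValue (hv : M.Candidate v) (p : ℝ) :
    BddAbove {x | ∃ F ∈ BayesPlausible p, M.infoCost F ≠ ∞ ∧
      x = ∫ q, v q ∂F - (M.infoCost F).toReal} := by
  obtain ⟨K, hK⟩ := hv.2.1
  refine ⟨K, ?_⟩
  rintro x ⟨F, hF, -, rfl⟩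
  have := hF.1
  have : ∫ q, v q ∂F ≤ ∫ q, K ∂F := integral_mono_ae (hv.integrable hF) (integrable_const K) (by
    filter_upwards [BayesPlausible.ae_mem hF] with q hq using (abs_le.1 (hK q hq)).2)
  simp only [integral_const, probReal_univ, one_smul] at this
  linarith [ENNReal.toReal_nonneg (a := M.infoCost F)]

theorem Candidate.le_infoValue (hv : M.Candidate v) {p : ℝ} {F : Measure ℝ}
    (hF : F ∈ BayesPlausible p) (hC : M.infoCost F ≠ ∞) :
    ∫ q, v q ∂F - (M.infoCost F).toReal ≤ M.infoValue v p :=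
  le_csSup (hv.bddAbove_infoValue p) ⟨F, hF, hC, rfl⟩

theorem infoValue_le {p y : ℝ} (hp : p ∈ Icc (0 : ℝ) 1)
    (h : ∀ F ∈ BayesPlausible p, M.infoCost F ≠ ∞ → ∫ q, v q ∂F - (M.infoCost F).toReal ≤ y) :
    M.infoValue v p ≤ y := by
  refine csSup_le ⟨_, Measure.dirac p, BayesPlausible.dirac_mem hp, ?_, rfl⟩ ?_
  · simp [infoCost_dirac]
  · rintro x ⟨F, hF, hC, rfl⟩
    exact h F hF hC

theorem Candidate.self_le_infoValue (hv : M.Candidate v) {p : ℝ} (hp : p ∈ Icc (0 : ℝ) 1) :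
    v p ≤ M.infoValue v p := by
  have := hv.le_infoValue (BayesPlausible.dirac_mem hp) (by simp [infoCost_dirac])
  simpa [infoCost_dirac] using this

theorem Candidate.infoValue_endpoint (hv : M.Candidate v) {p : ℝ} (hp : p = 0 ∨ p = 1) :
    M.infoValue v p = v p := by
  have hpI : p ∈ Icc (0 : ℝ) 1 := by rcases hp with rfl | rfl <;> simp
  refine le_antisymm (infoValue_le hpI fun F hF _ => ?_) (hv.self_le_infoValue hpI)
  have := hF.1
  have : ∫ q, v q ∂F = v p := by
    rw [integral_congr_ae (g := fun _ => v p)]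
    · simp
    · filter_upwards [BayesPlausible.ae_eq_of_endpoint hF hp] with q hq
      rw [hq]
  linarith [ENNReal.toReal_nonneg (a := M.infoCost F)]

theorem Candidate.abs_infoValue_le (hv : M.Candidate v) {K : ℝ}
    (hK : ∀ p ∈ Icc (0 : ℝ) 1, |v p| ≤ K) {p : ℝ} (hp : p ∈ Icc (0 : ℝ) 1) :
    |M.infoValue v p| ≤ K := by
  rw [abs_le]
  refine ⟨(abs_le.1 (hK p hp)).1.trans (hv.self_le_infoValue hp), infoValue_le hp fun F hF _ => ?_⟩
  have := hF.1
  have : ∫ q, v q ∂F ≤ ∫ q, K ∂F := integral_mono_ae (hv.integrable hF) (integrable_const K) (by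
    filter_upwards [BayesPlausible.ae_mem hF] with q hq using (abs_le.1 (hK q hq)).2)
  simp only [integral_const, probReal_univ, one_smul] at this
  linarith [ENNReal.toReal_nonneg (a := M.infoCost F)]

theorem lintegral_c_ne_top {p : ℝ} (hp : p ∈ M.costDomain) {F : Measure ℝ}
    (hF : F ∈ BayesPlausible p) (hC : M.infoCost F ≠ ∞) : ∫⁻ q, M.c q ∂F ≠ ∞ := by
  rintro h
  rw [infoCost, hF.2.2, h, ENNReal.top_sub hp.2] at hC
  exact hC rfl

theorem toReal_sub_toReal_le_infoCost {p : ℝ} (hp : p ∈ M.costDomain) {F : Measure ℝ}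
    (hF : F ∈ BayesPlausible p) :
    (∫⁻ q, M.c q ∂F).toReal - (M.c p).toReal ≤ (M.infoCost F).toReal := by
  rw [infoCost, hF.2.2]
  exact ENNReal.le_toReal_sub hp.2

/-- An experiment at `x` and one at `y`, mixed with the weights of a convex combination, form an
experiment at that combination, and ∫ (v - c) dF is linear in F. The result is a concave majorant of
the net value. It shows that the envelope is an infimum over a nonempty set, and it gives interior
continuity of `infoValue`. -/
theorem Candidate.infoValue_sub_concave (hv : M.Candidate v) :
    ConcaveOn ℝ M.costDomain fun p => M.infoValue v p - (M.c p).toReal := by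
  rw [concaveOn_iff_pairwise_pos]
  refine ⟨M.convexOn_c_toReal.1, fun x hx y hy hxy a b ha hb hab => ?_⟩
  -- A proper convex combination of distinct beliefs is interior, where Jensen's inequality for `c`
  -- holds and the subtraction in `infoCost` is not truncated.
  have hp : a * x + b * y ∈ Ioo (0 : ℝ) 1 := by
    obtain ⟨⟨hx0, hx1⟩, -⟩ := hx
    obtain ⟨⟨hy0, hy1⟩, -⟩ := hy
    obtain rfl : b = 1 - a := by linarith
    rcases lt_or_gt_of_ne hxy with h | h <;> constructor <;> nlinarith
  have hpD := M.Ioo_subset_costDomain hp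
  simp only [smul_eq_mul]
  have key : ∀ F₁ ∈ BayesPlausible x, M.infoCost F₁ ≠ ∞ → ∀ F₂ ∈ BayesPlausible y,
      M.infoCost F₂ ≠ ∞ → a * (∫ q, v q ∂F₁ - (M.infoCost F₁).toReal) +
        b * (∫ q, v q ∂F₂ - (M.infoCost F₂).toReal) ≤
      M.infoValue v (a * x + b * y) - (M.c (a * x + b * y)).toReal +
        a * (M.c x).toReal + b * (M.c y).toReal := by
    intro F₁ h₁ hC₁ F₂ h₂ hC₂
    lift a to ℝ≥0 using ha.le
    lift b to ℝ≥0 using hb.le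
    have hF := BayesPlausible.mix x y h₁ h₂ (a := a) (b := b) (by exact_mod_cast hab)
    have hl₁ := lintegral_c_ne_top hx h₁ hC₁
    have hl₂ := lintegral_c_ne_top hy h₂ hC₂
    have hl : ∫⁻ q, M.c q ∂(a • F₁ + b • F₂) = a * ∫⁻ q, M.c q ∂F₁ + b * ∫⁻ q, M.c q ∂F₂ := by
      rw [lintegral_add_measure, lintegral_smul_measure, lintegral_smul_measure]
      rfl
    have hfin : ∫⁻ q, M.c q ∂(a • F₁ + b • F₂) ≠ ∞ := by
      rw [hl]; finiteness
    have hlR : (∫⁻ q, M.c q ∂(a • F₁ + b • F₂)).toReal =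
        a * (∫⁻ q, M.c q ∂F₁).toReal + b * (∫⁻ q, M.c q ∂F₂).toReal := by
      rw [hl, ENNReal.toReal_add (by finiteness) (by finiteness), ENNReal.toReal_mul,
        ENNReal.toReal_mul]
      simp
    have hJ := M.c_toReal_le_lintegral hp hF hfin
    have hcost : (M.infoCost (a • F₁ + b • F₂)).toReal =
        (∫⁻ q, M.c q ∂(a • F₁ + b • F₂)).toReal - (M.c (a * x + b * y)).toReal := by
      rw [infoCost, hF.2.2, ENNReal.toReal_sub_of_le _ hfin]
      exact (ENNReal.toReal_le_toReal hpD.2 hfin).1 hJ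
    have hle := hv.le_infoValue hF (by
      rw [infoCost]; exact ne_top_of_le_ne_top hfin tsub_le_self)
    rw [hcost, hlR, integral_add_measure ((hv.integrable h₁).smul_measure_nnreal)
      ((hv.integrable h₂).smul_measure_nnreal), integral_smul_nnreal_measure,
      integral_smul_nnreal_measure] at hle
    simp only [NNReal.smul_def, smul_eq_mul] at hle
    have e₁ := mul_le_mul_of_nonneg_left (toReal_sub_toReal_le_infoCost hx h₁) ha.le
    have e₂ := mul_le_mul_of_nonneg_left (toReal_sub_toReal_le_infoCost hy h₂) hb.le
    linarith
  -- The suprema over the two experiments are taken one after the other; dividing by the positive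
  -- weight isolates each in turn.
  have step : ∀ F₁ ∈ BayesPlausible x, M.infoCost F₁ ≠ ∞ →
      ∫ q, v q ∂F₁ - (M.infoCost F₁).toReal ≤
      (M.infoValue v (a * x + b * y) - (M.c (a * x + b * y)).toReal +
        a * (M.c x).toReal + b * (M.c y).toReal - b * M.infoValue v y) / a := by
    intro F₁ h₁ hC₁
    rw [le_div_iff₀ ha]
    have : M.infoValue v y ≤
        (M.infoValue v (a * x + b * y) - (M.c (a * x + b * y)).toReal +
        a * (M.c x).toReal + b * (M.c y).toReal -
          a * (∫ q, v q ∂F₁ - (M.infoCost F₁).toReal)) / b := by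
      refine infoValue_le hy.1 fun F₂ h₂ hC₂ => ?_
      rw [le_div_iff₀ hb]
      linarith [key F₁ h₁ hC₁ F₂ h₂ hC₂]
    rw [le_div_iff₀ hb] at this
    linarith
  have := infoValue_le hx.1 step
  rw [le_div_iff₀ ha] at this
  linarith

theorem continuousOn_c_toReal : ContinuousOn (fun p => (M.c p).toReal) (Ioo 0 1) :=
  M.c_contDiff.continuousOn

theorem Candidate.continuousOn_infoValue (hv : M.Candidate v) :
    ContinuousOn (M.infoValue v) (Ioo 0 1) := by
  have h := ((hv.infoValue_sub_concave.subset M.Ioo_subset_costDomain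
    (convex_Ioo 0 1)).continuousOn isOpen_Ioo).add (continuousOn_c_toReal (M := M))
  exact h.congr fun p _ => by simp

end LearningModel

end

/-! ### Waiting values and continuity of the value function -/

noncomputable section

namespace LearningModel

variable (M : LearningModel)

/-- The discounted utility over a duration `τ` without information acquisition. -/
def flowValue (τ p : ℝ) : ℝ := ∫ t in (0 : ℝ)..τ, Real.exp (-M.r * t) * M.u (M.drift t p)

/-- The value of acquiring information after the time `τ`, with continuation value `v`. -/
def waitValue (v : ℝ → ℝ) (τ p : ℝ) : ℝ :=
  M.flowValue τ p + Real.exp (-M.r * τ) * (M.infoValue v (M.drift τ p) - M.kappa)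

theorem exists_abs_u_le : ∃ U, 0 ≤ U ∧ ∀ p ∈ Icc (0 : ℝ) 1, |M.u p| ≤ U := by
  obtain ⟨U, hU⟩ := isCompact_Icc.exists_bound_of_continuousOn M.u_cont
  exact ⟨U, (abs_nonneg _).trans (hU 0 (by simp)), fun p hp => hU p hp⟩

theorem exp_neg_r_le_one {t : ℝ} (ht : 0 ≤ t) : Real.exp (-M.r * t) ≤ 1 :=
  Real.exp_le_one_iff.2 (by nlinarith [M.r_pos])

theorem continuousOn_discounted {p : ℝ} (hp : p ∈ Icc (0 : ℝ) 1) :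
    ContinuousOn (fun t => Real.exp (-M.r * t) * M.u (M.drift t p)) (Ici 0) := by
  refine ContinuousOn.mul (by fun_prop) ?_
  exact M.u_cont.comp (M.continuous_drift_time p).continuousOn fun t ht => M.drift_mem_unit ht hp

theorem intervalIntegrable_discounted {p : ℝ} (hp : p ∈ Icc (0 : ℝ) 1) {a b : ℝ} (ha : 0 ≤ a)
    (hb : 0 ≤ b) :
    IntervalIntegrable (fun t => Real.exp (-M.r * t) * M.u (M.drift t p)) volume a b :=
  ((M.continuousOn_discounted hp).mono fun _ ht =>
    le_trans (le_min ha hb) ht.1).intervalIntegrable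

theorem abs_integral_discounted_le {g : ℝ → ℝ} {e τ : ℝ} (hτ : 0 ≤ τ) (he : 0 ≤ e)
    (hg : ∀ t, 0 ≤ t → |g t| ≤ e) :
    |∫ t in (0 : ℝ)..τ, Real.exp (-M.r * t) * g t| ≤ e / M.r := by
  have hr := M.r_pos
  have h1 : |∫ t in (0 : ℝ)..τ, Real.exp (-M.r * t) * g t| ≤
      ∫ t in (0 : ℝ)..τ, Real.exp (-M.r * t) * e := by
    have hcont : Continuous fun t => Real.exp (-M.r * t) * e := by fun_prop
    rw [← Real.norm_eq_abs]
    refine intervalIntegral.norm_integral_le_of_norm_le hτ ?_ (hcont.intervalIntegrable 0 τ)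
    refine Filter.Eventually.of_forall fun t ht => ?_
    rw [Real.norm_eq_abs, abs_mul, abs_of_pos (Real.exp_pos _)]
    exact mul_le_mul_of_nonneg_left (hg t ht.1.le) (Real.exp_pos _).le
  have h2 : ∫ t in (0 : ℝ)..τ, Real.exp (-M.r * t) * e = (1 - Real.exp (-M.r * τ)) / M.r * e := by
    rw [intervalIntegral.integral_mul_const,
      intervalIntegral.integral_comp_mul_left (fun x => Real.exp x) (neg_ne_zero.2 hr.ne'),
      integral_exp, mul_zero, Real.exp_zero, smul_eq_mul]
    field_simp
    ring
  rw [h2] at h1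
  refine h1.trans ?_
  rw [div_mul_eq_mul_div]
  gcongr
  nlinarith [Real.exp_pos (-M.r * τ)]

theorem flowValue_add {p s τ : ℝ} (hp : p ∈ Icc (0 : ℝ) 1) (hs : 0 ≤ s) (hτ : 0 ≤ τ) :
    M.flowValue (s + τ) p =
      M.flowValue s p + Real.exp (-M.r * s) * M.flowValue τ (M.drift s p) := by
  unfold flowValue
  rw [← intervalIntegral.integral_add_adjacent_intervals
    (M.intervalIntegrable_discounted hp le_rfl hs)
    (M.intervalIntegrable_discounted hp hs (add_nonneg hs hτ)),
    ← intervalIntegral.integral_const_mul]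
  congr 1
  have := intervalIntegral.integral_comp_add_left (a := 0) (b := τ)
    (fun t => Real.exp (-M.r * t) * M.u (M.drift t p)) s
  rw [add_zero] at this
  rw [← this]
  refine intervalIntegral.integral_congr fun t _ => ?_
  simp only [drift_drift]
  rw [← mul_assoc, ← Real.exp_add]
  ring_nf

theorem continuousOn_flowValue {p : ℝ} (hp : p ∈ Icc (0 : ℝ) 1) (T : ℝ) (hT : 0 ≤ T) :
    ContinuousOn (fun τ => M.flowValue τ p) (Icc 0 T) := by
  have := intervalIntegral.continuousOn_primitive_interval (μ := volume) (a := 0) (b := T)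
    (f := fun t => Real.exp (-M.r * t) * M.u (M.drift t p)) (by
      rw [uIcc_of_le hT]
      exact ((M.continuousOn_discounted hp).mono Icc_subset_Ici_self).integrableOn_Icc)
  rwa [uIcc_of_le hT] at this

theorem waitValue_zero (v : ℝ → ℝ) (p : ℝ) :
    M.waitValue v 0 p = M.infoValue v p - M.kappa := by
  simp [waitValue, flowValue, drift_zero]

theorem waitValue_add (v : ℝ → ℝ) {p s τ : ℝ} (hp : p ∈ Icc (0 : ℝ) 1) (hs : 0 ≤ s) (hτ : 0 ≤ τ) :
    M.waitValue v (s + τ) p =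
      M.flowValue s p + Real.exp (-M.r * s) * M.waitValue v τ (M.drift s p) := by
  have : Real.exp (-M.r * (s + τ)) = Real.exp (-M.r * s) * Real.exp (-M.r * τ) := by
    rw [← Real.exp_add]; ring_nf
  rw [waitValue, waitValue, M.flowValue_add hp hs hτ, drift_drift, this]
  ring

variable {M} {v : ℝ → ℝ}

theorem Candidate.exists_waitValue_le (hv : M.Candidate v) :
    ∃ B, ∀ p ∈ Icc (0 : ℝ) 1, ∀ τ, 0 ≤ τ → M.waitValue v τ p ≤ B := by
  obtain ⟨K, hK⟩ := hv.2.1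
  obtain ⟨U, hU0, hU⟩ := M.exists_abs_u_le
  refine ⟨U / M.r + K, fun p hp τ hτ => ?_⟩
  have h1 := (abs_le.1 (M.abs_integral_discounted_le hτ hU0
    fun t ht => hU _ (M.drift_mem_unit ht hp))).2
  have hK0 : 0 ≤ K := (abs_nonneg _).trans (hK p hp)
  have h2 := (abs_le.1 (hv.abs_infoValue_le hK (M.drift_mem_unit hτ hp))).2
  have h3 : Real.exp (-M.r * τ) * (M.infoValue v (M.drift τ p) - M.kappa) ≤ K := by
    have := M.exp_neg_r_le_one hτ
    have := M.kappa_pos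
    nlinarith [Real.exp_pos (-M.r * τ)]
  exact add_le_add h1 h3

namespace IsValueFunction

theorem waitValue_le (hv : M.IsValueFunction v) {p τ : ℝ} (hp : p ∈ Icc (0 : ℝ) 1) (hτ : 0 ≤ τ) :
    M.waitValue v τ p ≤ v p := by
  obtain ⟨B, hB⟩ := hv.1.exists_waitValue_le
  rw [← hv.2 p hp]
  refine le_csSup ⟨B, ?_⟩ ⟨τ, hτ, rfl⟩
  rintro x ⟨σ, hσ, rfl⟩
  exact hB p hp σ hσ

theorem le_of_waitValue_le (hv : M.IsValueFunction v) {p y : ℝ} (hp : p ∈ Icc (0 : ℝ) 1)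
    (h : ∀ τ, 0 ≤ τ → M.waitValue v τ p ≤ y) : v p ≤ y := by
  rw [← hv.2 p hp]
  refine csSup_le ⟨_, 0, le_rfl, rfl⟩ ?_
  rintro x ⟨σ, hσ, rfl⟩
  exact h σ hσ

theorem infoValue_sub_le (hv : M.IsValueFunction v) {p : ℝ} (hp : p ∈ Icc (0 : ℝ) 1) :
    M.infoValue v p - M.kappa ≤ v p := by
  simpa [waitValue_zero] using hv.waitValue_le hp le_rfl

/-- Every waiting time from the drifted belief, prolonged by `s`, is a feasible waiting time from
`p`. -/
theorem flowValue_add_le (hv : M.IsValueFunction v) {p s : ℝ} (hp : p ∈ Icc (0 : ℝ) 1)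
    (hs : 0 ≤ s) : M.flowValue s p + Real.exp (-M.r * s) * v (M.drift s p) ≤ v p := by
  have he := Real.exp_pos (-M.r * s)
  have : v (M.drift s p) ≤ (v p - M.flowValue s p) / Real.exp (-M.r * s) := by
    refine hv.le_of_waitValue_le (M.drift_mem_unit hs hp) fun τ hτ => ?_
    rw [le_div_iff₀ he]
    have h1 := hv.waitValue_le hp (add_nonneg hs hτ)
    rw [M.waitValue_add v hp hs hτ] at h1
    linarith
  rw [le_div_iff₀ he] at this
  linarith

/-- Drift contracts distances, so `waitValue` is equicontinuous in the belief, uniformly over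
waiting times, and the supremum inherits the modulus. -/
theorem continuousOn_Ioo (hv : M.IsValueFunction v) : ContinuousOn v (Ioo 0 1) := by
  obtain ⟨hpi0, hpi1⟩ := M.piBar_mem
  have hr := M.r_pos
  intro x hx
  refine ContinuousAt.continuousWithinAt ?_
  -- The interval [a,b] contains both `x` and the long run average, so drift maps it into itself; it
  -- stays inside (0,1), where `infoValue` is already known to be continuous.
  obtain ⟨a, ha0, ha⟩ := exists_between (lt_min hx.1 hpi0)
  obtain ⟨b, hb, hb1⟩ := exists_between (max_lt hx.2 hpi1)
  rw [lt_min_iff] at ha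
  rw [max_lt_iff] at hb
  have hsub : Icc a b ⊆ Ioo (0 : ℝ) 1 := fun y hy => ⟨ha0.trans_le hy.1, hy.2.trans_lt hb1⟩
  have hsub' := hsub.trans Ioo_subset_Icc_self
  rw [Metric.continuousAt_iff]
  intro ε hε
  -- An error `e` in the utility accumulates to at most `e / M.r` in the discounted flow; the other
  -- `e` is the error in `infoValue`.
  obtain ⟨e, he0, he⟩ : ∃ e, 0 < e ∧ e / M.r + e < ε := by
    refine ⟨ε / 2 * (M.r / (1 + M.r)), by positivity, ?_⟩
    have : ε / 2 * (M.r / (1 + M.r)) / M.r + ε / 2 * (M.r / (1 + M.r)) = ε / 2 := by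
      field_simp
    linarith
  obtain ⟨d₁, hd₁, hu⟩ := Metric.uniformContinuousOn_iff.1
    (isCompact_Icc.uniformContinuousOn_of_continuous M.u_cont) e he0
  obtain ⟨d₂, hd₂, hV⟩ := Metric.uniformContinuousOn_iff.1
    (isCompact_Icc.uniformContinuousOn_of_continuous (hv.1.continuousOn_infoValue.mono hsub)) e he0
  have key : ∀ p ∈ Icc a b, ∀ q ∈ Icc a b, |p - q| < d₁ → |p - q| < d₂ → ∀ τ, 0 ≤ τ →
      |M.waitValue v τ p - M.waitValue v τ q| ≤ e / M.r + e := by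
    intro p hp q hq h₁ h₂ τ hτ
    have hflow : |M.flowValue τ p - M.flowValue τ q| ≤ e / M.r := by
      rw [flowValue, flowValue, ← intervalIntegral.integral_sub
        (M.intervalIntegrable_discounted (hsub' hp) le_rfl hτ)
        (M.intervalIntegrable_discounted (hsub' hq) le_rfl hτ)]
      simp_rw [← mul_sub]
      refine M.abs_integral_discounted_le (g := fun t => M.u (M.drift t p) - M.u (M.drift t q))
        hτ he0.le fun t ht => ?_
      exact (hu _ (M.drift_mem_unit ht (hsub' hp)) _ (M.drift_mem_unit ht (hsub' hq))
        ((M.abs_drift_sub_drift_le ht).trans_lt h₁)).le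
    have hinfo : |M.infoValue v (M.drift τ p) - M.infoValue v (M.drift τ q)| ≤ e :=
      (hV _ (M.drift_mem_Icc ha.2.le hb.2.le hτ hp) _ (M.drift_mem_Icc ha.2.le hb.2.le hτ hq)
        ((M.abs_drift_sub_drift_le hτ).trans_lt h₂)).le
    have : M.waitValue v τ p - M.waitValue v τ q = (M.flowValue τ p - M.flowValue τ q) +
        Real.exp (-M.r * τ) * (M.infoValue v (M.drift τ p) - M.infoValue v (M.drift τ q)) := by
      simp only [waitValue]; ring
    rw [this]
    refine (abs_add_le _ _).trans (add_le_add hflow ?_)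
    rw [abs_mul, abs_of_pos (Real.exp_pos _)]
    exact (mul_le_of_le_one_left (abs_nonneg _) (M.exp_neg_r_le_one hτ)).trans hinfo
  have half : ∀ p ∈ Icc a b, ∀ q ∈ Icc a b, |p - q| < d₁ → |p - q| < d₂ →
      v p ≤ v q + (e / M.r + e) := by
    intro p hp q hq h₁ h₂
    refine hv.le_of_waitValue_le (hsub' hp) fun τ hτ => ?_
    have h3 := (abs_le.1 (key p hp q hq h₁ h₂ τ hτ)).2
    have h4 := hv.waitValue_le (hsub' hq) hτ
    linarith
  refine ⟨min (min d₁ d₂) (min (x - a) (b - x)),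
    lt_min (lt_min hd₁ hd₂) (lt_min (by linarith) (by linarith)), fun {y} hy => ?_⟩
  rw [Real.dist_eq] at hy ⊢
  simp only [lt_min_iff] at hy
  obtain ⟨⟨h₁, h₂⟩, h₃, h₄⟩ := hy
  have hyI : y ∈ Icc a b := by
    constructor <;> linarith [(abs_lt.1 h₃).1, (abs_lt.1 h₄).2]
  have hxI : x ∈ Icc a b := ⟨ha.1.le, hb.1.le⟩
  have g1 := half y hyI x hxI h₁ h₂
  rw [abs_sub_comm] at h₁ h₂
  have g2 := half x hxI y hyI h₁ h₂
  rw [abs_lt]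
  constructor <;> linarith

/-- Nearby beliefs are reached by drifting from the endpoint for a short time, so continuity along
that single drift path suffices. This avoids continuity of `infoValue` at the endpoint, which is not
yet available. -/
theorem continuousWithinAt_endpoint (hv : M.IsValueFunction v) {e : ℝ} (he : e = 0 ∨ e = 1) :
    ContinuousWithinAt v (Icc 0 1) e := by
  obtain ⟨hpi0, hpi1⟩ := M.piBar_mem
  have heI : e ∈ Icc (0 : ℝ) 1 := by rcases he with rfl | rfl <;> simp
  have hepi : e - M.piBar ≠ 0 := by rcases he with rfl | rfl <;> linarith
  have hκ := M.kappa_pos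
  -- continuity along the drift from the endpoint
  have hdrift : Filter.Tendsto (fun s => v (M.drift s e)) (nhdsWithin 0 (Ici 0)) (nhds (v e)) := by
    have hflow : Filter.Tendsto (fun s => M.flowValue s e) (nhdsWithin 0 (Ici 0)) (nhds 0) := by
      have := M.continuousOn_flowValue heI 1 zero_le_one 0 (by simp)
      rw [ContinuousWithinAt, show M.flowValue 0 e = 0 by simp [flowValue]] at this
      refine this.mono_left (nhdsWithin_le_of_mem (Icc_mem_nhdsGE one_pos))
    have hexp : Filter.Tendsto (fun s => Real.exp (-M.r * s)) (nhdsWithin 0 (Ici 0)) (nhds 1) := by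
      have : Continuous fun s => Real.exp (-M.r * s) := by fun_prop
      have := this.tendsto 0
      simp only [mul_zero, Real.exp_zero] at this
      exact this.mono_left nhdsWithin_le_nhds
    have hquot (y : ℝ) : Filter.Tendsto (fun s => (y - M.flowValue s e) / Real.exp (-M.r * s))
        (nhdsWithin 0 (Ici 0)) (nhds y) := by
      have := ((tendsto_const_nhds (x := y)).sub hflow).div hexp one_ne_zero
      rwa [sub_zero, div_one] at this
    rw [tendsto_order]
    constructor
    · intro y hy
      -- Acquiring at once at the endpoint yields only v(e) - κ, so a waiting time worth more than
      -- `z` is positive. After drifting for less than that time, its remainder is still feasible.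
      obtain ⟨z, hyz, hz⟩ := exists_between (max_lt hy (sub_lt_self (v e) hκ))
      rw [max_lt_iff] at hyz
      obtain ⟨τ, hτ, hzτ⟩ : ∃ τ, 0 ≤ τ ∧ z < M.waitValue v τ e := by
        by_contra! h
        exact absurd (hv.le_of_waitValue_le heI h) (not_le.2 hz)
      have hτ0 : 0 < τ := by
        refine lt_of_le_of_ne hτ ?_
        rintro rfl
        rw [waitValue_zero, hv.1.infoValue_endpoint he] at hzτ
        linarith [hyz.2]
      have hlim := (hquot (M.waitValue v τ e)).eventually (lt_mem_nhds (hyz.1.trans hzτ))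
      filter_upwards [hlim, Ico_mem_nhdsGE hτ0] with s hs hsτ
      refine hs.trans_le ?_
      have h := M.waitValue_add v heI hsτ.1 (sub_nonneg.2 hsτ.2.le)
      rw [add_sub_cancel] at h
      rw [h, add_sub_cancel_left, mul_div_cancel_left₀ _ (Real.exp_pos _).ne']
      exact hv.waitValue_le (M.drift_mem_unit hsτ.1 heI) (sub_nonneg.2 hsτ.2.le)
    · intro y hy
      have hlim := (hquot (v e)).eventually (gt_mem_nhds hy)
      filter_upwards [hlim, self_mem_nhdsWithin] with s hs hs0
      refine lt_of_le_of_lt ?_ hs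
      rw [le_div_iff₀ (Real.exp_pos _)]
      linarith [hv.flowValue_add_le heI hs0]
  have hratio : Filter.Tendsto (fun p => (p - M.piBar) / (e - M.piBar)) (nhdsWithin e (Icc 0 1))
      (nhds 1) := by
    have : Continuous fun p => (p - M.piBar) / (e - M.piBar) := by fun_prop
    have := this.tendsto e
    rw [div_self hepi] at this
    exact this.mono_left nhdsWithin_le_nhds
  have hpos : ∀ᶠ p in nhdsWithin e (Icc 0 1), 0 < (p - M.piBar) / (e - M.piBar) :=
    hratio.eventually (lt_mem_nhds one_pos)
  have hle : ∀ p ∈ Icc (0 : ℝ) 1, (p - M.piBar) / (e - M.piBar) ≤ 1 := by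
    rintro p ⟨hp0, hp1⟩
    rcases he with rfl | rfl
    · rw [div_le_one_of_neg (by linarith)]; linarith
    · rw [div_le_one (by linarith)]; linarith
  have htime : Filter.Tendsto (M.travelTime e) (nhdsWithin e (Icc 0 1))
      (nhdsWithin 0 (Ici 0)) := by
    rw [tendsto_nhdsWithin_iff]
    constructor
    · have := ((Real.continuousAt_log one_ne_zero).tendsto.comp hratio).neg.div_const M.lam
      rw [Real.log_one, neg_zero, zero_div] at this
      exact this
    · filter_upwards [hpos, self_mem_nhdsWithin] with p hp hpI
      exact M.travelTime_nonneg hp (hle p hpI)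
  refine (hdrift.comp htime).congr' ?_
  filter_upwards [hpos] with p hp
  simp [M.drift_travelTime hp]

theorem continuousOn (hv : M.IsValueFunction v) : ContinuousOn v (Icc 0 1) := by
  intro x hx
  by_cases h0 : x = 0
  · exact hv.continuousWithinAt_endpoint (Or.inl h0) |>.mono_of_mem_nhdsWithin self_mem_nhdsWithin
  by_cases h1 : x = 1
  · exact hv.continuousWithinAt_endpoint (Or.inr h1) |>.mono_of_mem_nhdsWithin self_mem_nhdsWithin
  have hxo : x ∈ Ioo (0 : ℝ) 1 := ⟨lt_of_le_of_ne hx.1 (Ne.symm h0), lt_of_le_of_ne hx.2 h1⟩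
  exact (hv.continuousOn_Ioo.continuousAt (Ioo_mem_nhds hxo.1 hxo.2)).continuousWithinAt

end IsValueFunction
end LearningModel

end

/-! ### The residual value of information, its continuity and its consequences -/

noncomputable section

section Envelope
variable {S : Set ℝ} {g h : ℝ → ℝ} {p y : ℝ}

theorem concaveEnvelope_le (hp : p ∈ S) (hh : ConcaveOn ℝ S h) (hgh : ∀ x ∈ S, g x ≤ h x) :
    concaveEnvelope S g p ≤ h p :=
  csInf_le ⟨g p, by rintro _ ⟨k, -, hk, rfl⟩; exact hk p hp⟩ ⟨h, hh, hgh, rfl⟩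

/-- The majorant `h` serves only to make the infimum range over a nonempty set; otherwise `sInf`
would have its default value 0. -/
theorem le_concaveEnvelope (hh : ConcaveOn ℝ S h) (hgh : ∀ x ∈ S, g x ≤ h x)
    (hy : ∀ k : ℝ → ℝ, ConcaveOn ℝ S k → (∀ x ∈ S, g x ≤ k x) → y ≤ k p) :
    y ≤ concaveEnvelope S g p :=
  le_csInf ⟨_, h, hh, hgh, rfl⟩ (by rintro _ ⟨k, hk, hgk, rfl⟩; exact hy k hk hgk)

end Envelope

namespace LearningModel

variable {M : LearningModel} {v : ℝ → ℝ}

theorem residualValue_of_mem {p : ℝ} (hp : p ∈ M.costDomain) : M.residualValue v p =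
    concaveEnvelope M.costDomain (M.netValue v) p - M.netValue v p := by
  simp [residualValue, hp]

theorem residualValue_of_notMem {p : ℝ} (hp : p ∉ M.costDomain) : M.residualValue v p = 0 := by
  simp [residualValue, hp]

theorem Candidate.netValue_le_infoValue_sub (hv : M.Candidate v) :
    ∀ p ∈ M.costDomain, M.netValue v p ≤ M.infoValue v p - (M.c p).toReal :=
  fun _ hp => sub_le_sub_right (hv.self_le_infoValue hp.1) _

theorem Candidate.residualValue_nonneg (hv : M.Candidate v) (p : ℝ) :
    0 ≤ M.residualValue v p := by
  by_cases hp : p ∈ M.costDomain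
  · rw [residualValue_of_mem hp, sub_nonneg]
    exact le_concaveEnvelope hv.infoValue_sub_concave hv.netValue_le_infoValue_sub
      fun k _ hk => hk p hp
  · rw [residualValue_of_notMem hp]

/-- The residual value of information is the value of information gross of the fixed cost. -/
theorem Candidate.infoValue_eq (hv : M.Candidate v) {p : ℝ} (hp : p ∈ Icc (0 : ℝ) 1) :
    M.infoValue v p = v p + M.residualValue v p := by
  have hend : p ∉ Ioo (0 : ℝ) 1 → M.infoValue v p = v p := fun h => by
    refine hv.infoValue_endpoint ?_
    by_contra! h'
    exact h ⟨lt_of_le_of_ne hp.1 (Ne.symm h'.1), lt_of_le_of_ne hp.2 h'.2⟩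
  by_cases hpD : p ∈ M.costDomain
  swap
  · rw [residualValue_of_notMem hpD, hend fun h => hpD (M.Ioo_subset_costDomain h), add_zero]
  refine le_antisymm ?_ ?_
  · by_cases hpo : p ∈ Ioo (0 : ℝ) 1
    swap
    · rw [hend hpo]
      linarith [hv.residualValue_nonneg p]
    refine infoValue_le hp fun F hF hC => ?_
    rw [residualValue_of_mem hpD, netValue]
    suffices ∫ q, v q ∂F - (M.infoCost F).toReal - (M.c p).toReal ≤
        concaveEnvelope M.costDomain (M.netValue v) p by linarith
    refine le_concaveEnvelope hv.infoValue_sub_concave hv.netValue_le_infoValue_sub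
      fun k hk hwk => ?_
    -- A supporting line of the concave majorant `k` at `p` dominates v - c wherever `c` is finite.
    -- Integrating against F, whose mean is `p`, turns the line into k(p).
    obtain ⟨m, hm⟩ := hk.neg.exists_forall_add_mul_le (M.mem_interior_costDomain hpo)
    have hle : ∫ q, (v q - (k p + -m * (q - p))) ∂F ≤ (∫⁻ q, M.c q ∂F).toReal := by
      refine integral_le_toReal_lintegral
        ((hv.integrable hF).sub (BayesPlausible.integrable_affine hF _ _)) ?_
        (lintegral_c_ne_top hpD hF hC)
      filter_upwards [BayesPlausible.ae_mem hF] with q hq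
      by_cases hc : M.c q = ∞
      · rw [hc]; exact le_top
      · refine (ENNReal.ofReal_le_iff_le_toReal hc).2 ?_
        have h1 := hm q ⟨hq, hc⟩
        have h2 := hwk q ⟨hq, hc⟩
        simp only [Pi.neg_apply, netValue] at h1 h2
        linarith
    rw [integral_sub (hv.integrable hF) (BayesPlausible.integrable_affine hF _ _),
      BayesPlausible.integral_affine hF] at hle
    linarith [toReal_sub_toReal_le_infoCost hpD hF]
  · have := concaveEnvelope_le hpD hv.infoValue_sub_concave hv.netValue_le_infoValue_sub
    rw [residualValue_of_mem hpD]
    simp only [netValue] at this ⊢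
    linarith

theorem Candidate.residualValue_endpoint (hv : M.Candidate v) {e : ℝ} (he : e = 0 ∨ e = 1) :
    M.residualValue v e = 0 := by
  have h1 := hv.infoValue_eq (p := e) (by rcases he with rfl | rfl <;> simp)
  rw [hv.infoValue_endpoint he] at h1
  linarith

/-- The residual value is bounded by the distance to any affine majorant of the value function. -/
theorem residualValue_le_of_affine_majorant {a m : ℝ}
    (h : ∀ q ∈ Icc (0 : ℝ) 1, v q ≤ a + m * q) {p : ℝ} (hp : p ∈ Icc (0 : ℝ) 1) :
    M.residualValue v p ≤ a + m * p - v p := by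
  by_cases hpD : p ∈ M.costDomain
  · have hconc : ConcaveOn ℝ M.costDomain fun q => a + m * q - (M.c q).toReal := by
      refine ConcaveOn.sub ⟨M.convexOn_c_toReal.1, fun x _ y _ s t _ _ hst => ?_⟩
        M.convexOn_c_toReal
      obtain rfl : t = 1 - s := by linarith
      simp only [smul_eq_mul]
      apply le_of_eq
      ring
    have := concaveEnvelope_le hpD hconc (g := M.netValue v)
      fun q hq => sub_le_sub_right (h q hq.1) _
    rw [residualValue_of_mem hpD, netValue]
    linarith
  · rw [residualValue_of_notMem hpD]
    linarith [h p hp]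

namespace IsValueFunction

theorem residualValue_le_kappa (hv : M.IsValueFunction v) {p : ℝ} (hp : p ∈ Icc (0 : ℝ) 1) :
    M.residualValue v p ≤ M.kappa := by
  have := hv.infoValue_sub_le hp
  rw [hv.1.infoValue_eq hp] at this
  linarith

theorem continuousWithinAt_residualValue_endpoint (hv : M.IsValueFunction v) {e : ℝ}
    (he : e = 0 ∨ e = 1) : ContinuousWithinAt (M.residualValue v) (Icc 0 1) e := by
  obtain ⟨K, hK⟩ := hv.1.2.1
  have heI : e ∈ Icc (0 : ℝ) 1 := by rcases he with rfl | rfl <;> simp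
  have hK0 : 0 ≤ K := (abs_nonneg _).trans (hK e heI)
  have hcont := hv.continuousOn e heI
  rw [ContinuousWithinAt, hv.1.residualValue_endpoint he, tendsto_order]
  refine ⟨fun y hy => Filter.Eventually.of_forall fun p =>
      hy.trans_le (hv.1.residualValue_nonneg p),
    fun y hy => ?_⟩
  obtain ⟨d, hd, hvd⟩ := Metric.continuousWithinAt_iff.1 hcont (y / 2) (by linarith)
  obtain ⟨s, hs⟩ : ∃ s : ℝ, ∀ q ∈ Icc (0 : ℝ) 1, |q - e| = s * (q - e) := by
    rcases he with rfl | rfl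
    · exact ⟨1, fun q hq => by rw [abs_of_nonneg (by linarith [hq.1])]; ring⟩
    · exact ⟨-1, fun q hq => by rw [abs_of_nonpos (by linarith [hq.2])]; ring⟩
  -- The affine majorant starts at v(e) + y/2 and has slope 2K/d away from the endpoint. Continuity
  -- of `v` covers distances below `d`; beyond, the line has risen by 2K, the largest possible
  -- oscillation of `v`.
  have hmaj : ∀ q ∈ Icc (0 : ℝ) 1,
      v q ≤ (v e + y / 2 - 2 * K / d * s * e) + 2 * K / d * s * q := by
    intro q hq
    have h1 : 2 * K / d * s * q - 2 * K / d * s * e = 2 * K / d * |q - e| := by rw [hs q hq]; ring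
    have h2 : 0 ≤ 2 * K / d * |q - e| := by positivity
    by_cases hqd : |q - e| < d
    · have := hvd hq (by rwa [Real.dist_eq])
      rw [Real.dist_eq] at this
      linarith [(abs_lt.1 this).2]
    · have h3 : 2 * K ≤ 2 * K / d * |q - e| := by
        rw [div_mul_eq_mul_div, le_div_iff₀ hd]
        exact mul_le_mul_of_nonneg_left (not_lt.1 hqd) (by linarith)
      linarith [(abs_le.1 (hK q hq)).2, (abs_le.1 (hK e heI)).1]
  have hlim : Filter.Tendsto
      (fun p => (v e + y / 2 - 2 * K / d * s * e) + 2 * K / d * s * p - v p)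
      (nhdsWithin e (Icc 0 1)) (nhds (y / 2)) := by
    have haff : ContinuousWithinAt
        (fun p => (v e + y / 2 - 2 * K / d * s * e) + 2 * K / d * s * p) (Icc 0 1) e := by fun_prop
    have hval : v e + y / 2 - 2 * K / d * s * e + 2 * K / d * s * e - v e = y / 2 := by ring
    have := Filter.Tendsto.sub haff.tendsto hcont.tendsto
    rwa [hval] at this
  filter_upwards [hlim.eventually (gt_mem_nhds (by linarith : y / 2 < y)), self_mem_nhdsWithin]
    with p hp hpI using (residualValue_le_of_affine_majorant hmaj hpI).trans_lt hp

theorem continuousOn_residualValue (hv : M.IsValueFunction v) :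
    ContinuousOn (M.residualValue v) (Icc 0 1) := by
  intro x hx
  by_cases h0 : x = 0
  · exact hv.continuousWithinAt_residualValue_endpoint (Or.inl h0)
  by_cases h1 : x = 1
  · exact hv.continuousWithinAt_residualValue_endpoint (Or.inr h1)
  have hxo : x ∈ Ioo (0 : ℝ) 1 := ⟨lt_of_le_of_ne hx.1 (Ne.symm h0), lt_of_le_of_ne hx.2 h1⟩
  have h := hv.1.continuousOn_infoValue.sub hv.continuousOn_Ioo
  have h' : ContinuousOn (M.residualValue v) (Ioo 0 1) := h.congr fun p hp => by
    simp [hv.1.infoValue_eq (Ioo_subset_Icc_self hp)]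
  exact (h'.continuousAt (Ioo_mem_nhds hxo.1 hxo.2)).continuousWithinAt

theorem continuousOn_infoValue_Icc (hv : M.IsValueFunction v) :
    ContinuousOn (M.infoValue v) (Icc 0 1) :=
  (hv.continuousOn.add hv.continuousOn_residualValue).congr fun _ hp => hv.1.infoValue_eq hp

theorem isClosed_infoRegion (hv : M.IsValueFunction v) : IsClosed (M.infoRegion v) := by
  have := hv.continuousOn_residualValue.preimage_isClosed_of_isClosed isClosed_Icc
    (isClosed_singleton (x := M.kappa))
  exact this

theorem isClosed_diff_grossRegion (hv : M.IsValueFunction v) :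
    IsClosed (Icc (0 : ℝ) 1 \ M.grossRegion v) := by
  have := hv.continuousOn_residualValue.preimage_isClosed_of_isClosed isClosed_Icc
    (isClosed_Iic (a := (0 : ℝ)))
  convert this using 1
  ext p
  simp only [grossRegion, mem_sdiff, mem_ofPred_eq, not_and, not_lt, mem_inter_iff, mem_preimage,
    mem_Iic]
  tauto

theorem endpoint_mem (hv : M.IsValueFunction v) {e : ℝ} (he : e = 0 ∨ e = 1) :
    e ∈ Icc (0 : ℝ) 1 \ M.grossRegion v :=
  ⟨by rcases he with rfl | rfl <;> simp, fun h => by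
    have := h.2
    rw [hv.1.residualValue_endpoint he] at this
    exact lt_irrefl _ this⟩

/-- Beliefs at which information is acquired are bounded away from beliefs without gross value of
information. -/
theorem exists_separation (hv : M.IsValueFunction v) : ∃ d, 0 < d ∧ d ≤ 1 / 2 ∧
    ∀ p ∈ M.infoRegion v, ∀ q ∈ Icc (0 : ℝ) 1 \ M.grossRegion v, d ≤ |p - q| := by
  obtain ⟨d, hd, h⟩ := Metric.uniformContinuousOn_iff.1
    (isCompact_Icc.uniformContinuousOn_of_continuous hv.continuousOn_residualValue) M.kappa
    M.kappa_pos
  refine ⟨min d (1 / 2), by positivity, min_le_right _ _, fun p hp q hq => ?_⟩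
  by_contra! hlt
  have h1 := h p hp.1 q hq.1 (by rw [Real.dist_eq]; exact hlt.trans_le (min_le_left _ _))
  have h2 : M.residualValue v q ≤ 0 := by
    by_contra! h'
    exact hq.2 ⟨hq.1, h'⟩
  rw [Real.dist_eq, hp.2] at h1
  linarith [(abs_lt.1 h1).2]

/-- If beliefs never drift into the acquisition region, never acquiring information is optimal. -/
theorem le_lowerValue (hv : M.IsValueFunction v) {p : ℝ} (hp : p ∈ Icc (0 : ℝ) 1)
    (hI : ∀ t, 0 ≤ t → M.drift t p ∉ M.infoRegion v) : v p ≤ M.lowerValue p := by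
  obtain ⟨K, hK⟩ := hv.1.2.1
  obtain ⟨U, hU0, hU⟩ := M.exists_abs_u_le
  have hr := M.r_pos
  -- Outside the acquisition region Δ < κ, so acquiring at any finite time is strictly worse than
  -- continuing optimally.
  have hstrict : ∀ τ, 0 ≤ τ → M.waitValue v τ p < v p := by
    intro τ hτ
    have hd := M.drift_mem_unit hτ hp
    have h1 := hv.flowValue_add_le hp hτ
    have h2 : M.residualValue v (M.drift τ p) < M.kappa :=
      lt_of_le_of_ne (hv.residualValue_le_kappa hd) fun h => hI τ hτ ⟨hd, h⟩
    have h3 := mul_lt_mul_of_pos_left h2 (Real.exp_pos (-M.r * τ))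
    rw [waitValue, hv.1.infoValue_eq hd]
    linarith
  have hexp : Filter.Tendsto (fun t : ℝ => Real.exp (-M.r * t)) Filter.atTop (nhds 0) :=
    Real.tendsto_exp_atBot.comp (Filter.tendsto_id.const_mul_atTop_of_neg (by linarith))
  have hint : IntegrableOn (fun t => Real.exp (-M.r * t) * M.u (M.drift t p)) (Ioi 0) := by
    have hexpint : IntegrableOn (fun t => U * Real.exp (-M.r * t)) (Ioi 0) :=
      (exp_neg_integrableOn_Ioi 0 hr).const_mul U
    refine hexpint.mono' (((M.continuousOn_discounted hp).mono
      Ioi_subset_Ici_self).aestronglyMeasurable measurableSet_Ioi) ?_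
    filter_upwards [ae_restrict_mem measurableSet_Ioi] with t ht
    rw [Real.norm_eq_abs, abs_mul, abs_of_pos (Real.exp_pos _), mul_comm]
    exact mul_le_mul_of_nonneg_right (hU _ (M.drift_mem_unit (le_of_lt ht) hp)) (Real.exp_pos _).le
  have hflow : Filter.Tendsto (fun τ => M.flowValue τ p) Filter.atTop (nhds (M.lowerValue p)) :=
    intervalIntegral_tendsto_integral_Ioi 0 hint Filter.tendsto_id
  have hlim : Filter.Tendsto (fun τ => M.waitValue v τ p) Filter.atTop (nhds (M.lowerValue p)) := by
    have h0 : Filter.Tendsto (fun τ => Real.exp (-M.r * τ) *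
        (M.infoValue v (M.drift τ p) - M.kappa)) Filter.atTop (nhds 0) := by
      refine squeeze_zero_norm' (a := fun τ => Real.exp (-M.r * τ) * (K + M.kappa)) ?_
        (by simpa using hexp.mul_const (K + M.kappa))
      filter_upwards [Filter.eventually_ge_atTop 0] with τ hτ
      rw [Real.norm_eq_abs, abs_mul, abs_of_pos (Real.exp_pos _)]
      refine mul_le_mul_of_nonneg_left ((abs_sub _ _).trans ?_) (Real.exp_pos _).le
      rw [abs_of_pos M.kappa_pos]
      exact add_le_add_left (hv.1.abs_infoValue_le hK (M.drift_mem_unit hτ hp)) _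
    simpa [waitValue] using hflow.add h0
  -- If `v p` exceeded the value of never acquiring, late waiting times would be worth less than
  -- some m < v(p), while over the remaining compact range the maximum is attained and strictly
  -- below `v p`. The supremum could then not equal `v p`.
  by_contra! hlt
  obtain ⟨m, hm1, hm2⟩ := exists_between hlt
  obtain ⟨T, hT⟩ := Filter.eventually_atTop.1 (hlim.eventually (gt_mem_nhds hm1))
  have hcont : ContinuousOn (fun τ => M.waitValue v τ p) (Icc 0 (max T 0)) := by
    refine (M.continuousOn_flowValue hp _ (le_max_right _ _)).add
      (ContinuousOn.mul (by fun_prop) (ContinuousOn.sub ?_ continuousOn_const))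
    exact hv.continuousOn_infoValue_Icc.comp (M.continuous_drift_time p).continuousOn
      fun t ht => M.drift_mem_unit ht.1 hp
  obtain ⟨σ, hσ, hmax⟩ := isCompact_Icc.exists_isMaxOn (nonempty_Icc.2 (le_max_right T 0)) hcont
  have hle : v p ≤ max (M.waitValue v σ p) m := by
    refine hv.le_of_waitValue_le hp fun τ hτ => ?_
    by_cases h : τ ≤ max T 0
    · exact (hmax ⟨hτ, h⟩).trans (le_max_left _ _)
    · exact (hT τ ((le_max_left _ _).trans (not_le.1 h).le)).le.trans (le_max_right _ _)
  exact absurd hle (not_le.2 (max_lt (hstrict σ hσ.1) hm2))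

theorem continuousOn_lowerValue (M : LearningModel) : ContinuousOn M.lowerValue (Icc 0 1) := by
  obtain ⟨U, hU0, hU⟩ := M.exists_abs_u_le
  refine continuousOn_of_dominated (bound := fun t => U * Real.exp (-M.r * t)) ?_ ?_
    ((exp_neg_integrableOn_Ioi 0 M.r_pos).const_mul U) ?_
  · exact fun p hp => ((M.continuousOn_discounted hp).mono
      Ioi_subset_Ici_self).aestronglyMeasurable measurableSet_Ioi
  · intro p hp
    filter_upwards [ae_restrict_mem measurableSet_Ioi] with t ht
    rw [Real.norm_eq_abs, abs_mul, abs_of_pos (Real.exp_pos _), mul_comm]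
    exact mul_le_mul_of_nonneg_right (hU _ (M.drift_mem_unit (le_of_lt ht) hp)) (Real.exp_pos _).le
  · filter_upwards [ae_restrict_mem measurableSet_Ioi] with t ht
    refine continuousOn_const.mul (M.u_cont.comp ?_ fun p hp => M.drift_mem_unit (le_of_lt ht) hp)
    unfold drift
    fun_prop

/-- If beliefs drift from some prior to the long run average without entering the acquisition
region, never acquiring information is optimal at the long run average. -/
theorem piBar_eq_lowerValue (hv : M.IsValueFunction v) {p : ℝ} (hp : p ∈ Icc (0 : ℝ) 1)
    (hI : ∀ t, 0 ≤ t → M.drift t p ∉ M.infoRegion v) : v M.piBar = M.lowerValue M.piBar := by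
  have hpi : M.piBar ∈ Icc (0 : ℝ) 1 :=
  Ioo_subset_Icc_self M.piBar_mem
  refine le_antisymm ?_ (hv.1.2.2 _ hpi).1
  have hnhds : Filter.Tendsto (fun t => M.drift t p) Filter.atTop
      (nhdsWithin M.piBar (Icc 0 1)) := by
    rw [tendsto_nhdsWithin_iff]
    refine ⟨M.tendsto_drift p, ?_⟩
    filter_upwards [Filter.eventually_ge_atTop 0] with t ht using M.drift_mem_unit ht hp
  refine le_of_tendsto_of_tendsto ((hv.continuousOn _ hpi).tendsto.comp hnhds)
    ((continuousOn_lowerValue M _ hpi).tendsto.comp hnhds) ?_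
  -- Each point of the drift path also has a path that misses the acquisition region, so the
  -- inequality holds along the path and passes to its limit.
  filter_upwards [Filter.eventually_ge_atTop 0] with t ht
  refine hv.le_lowerValue (M.drift_mem_unit ht hp) fun s hs => ?_
  rw [drift_drift]
  exact hI _ (add_nonneg ht hs)

end IsValueFunction
end LearningModel

end

/-! ### Target beliefs, sample paths and almost sure termination -/

noncomputable section

namespace LearningModel

variable {M : LearningModel} {v : ℝ → ℝ}

/-- The beliefs without gross value of information. -/
def targetSet (M : LearningModel) (v : ℝ → ℝ) : Set ℝ := Icc (0 : ℝ) 1 \ M.grossRegion v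

/-- The belief at which information is next acquired from `x`. -/
def acqBelief (M : LearningModel) (v : ℝ → ℝ) (x : ℝ) : ℝ := M.drift (M.waitTime v x).toReal x

theorem waitTime_eq_top_iff {x : ℝ} :
    M.waitTime v x = ∞ ↔ ∀ t, 0 ≤ t → M.drift t x ∉ M.infoRegion v := by
  constructor
  · intro h t ht hI
    have : M.waitTime v x ≤ ENNReal.ofReal t := sInf_le ⟨t, ht, hI, rfl⟩
    rw [h] at this
    exact ENNReal.ofReal_ne_top (top_le_iff.1 this)
  · intro h
    rw [waitTime, sInf_eq_top]
    rintro _ ⟨t, ht, hI, rfl⟩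
    exact absurd hI (h t ht)

theorem waitTime_ne_top {x t : ℝ} (ht : 0 ≤ t) (h : M.drift t x ∈ M.infoRegion v) :
    M.waitTime v x ≠ ∞ := fun h' => waitTime_eq_top_iff.1 h' t ht h

theorem updatedBelief_succ {p₀ : ℝ} {ω : ℕ → unitInterval} {n : ℕ}
    (h : M.waitTime v (M.updatedBelief v p₀ ω n) ≠ ∞) :
    M.updatedBelief v p₀ ω (n + 1) =
      M.posterior v (M.acqBelief v (M.updatedBelief v p₀ ω n)) (ω n) := by
  unfold updatedBelief at h ⊢
  rw [state]
  simp only [h, if_false]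
  rfl

theorem updatedBelief_succ_of_eq_top {p₀ : ℝ} {ω : ℕ → unitInterval} {n : ℕ}
    (h : M.waitTime v (M.updatedBelief v p₀ ω n) = ∞) :
    M.updatedBelief v p₀ ω (n + 1) = M.updatedBelief v p₀ ω n := by
  unfold updatedBelief at h ⊢
  rw [state]
  simp only [h, if_true]

theorem acqTime_succ (p₀ : ℝ) (ω : ℕ → unitInterval) (n : ℕ) :
    M.acqTime v p₀ ω (n + 1) =
      M.acqTime v p₀ ω n + M.waitTime v (M.updatedBelief v p₀ ω n) := rfl

theorem acqTime_eq_top {p₀ : ℝ} {ω : ℕ → unitInterval} {n m : ℕ}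
    (h : M.waitTime v (M.updatedBelief v p₀ ω n) = ∞) (hm : n < m) :
    M.acqTime v p₀ ω m = ∞ := by
  induction m, hm using Nat.le_induction with
  | base => rw [acqTime_succ, h, add_top]
  | succ k _ ih => rw [acqTime_succ, ih, top_add]

theorem finitelyOften_of_waitTime_eq_top {p₀ : ℝ} {ω : ℕ → unitInterval} {n : ℕ}
    (h : M.waitTime v (M.updatedBelief v p₀ ω n) = ∞) : M.FinitelyOften v p₀ ω := by
  refine (Set.finite_Iic n).subset fun m hm => ?_
  by_contra hnm
  exact hm.2 (acqTime_eq_top h (not_le.1 hnm))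

theorem posterior_cases (p s : ℝ) :
    M.posterior v p s = M.lowerTarget v p ∨ M.posterior v p s = M.upperTarget v p := by
  unfold posterior
  split_ifs <;> simp

namespace IsValueFunction

variable {p q a x d : ℝ}

theorem lowerTarget_spec (hv : M.IsValueFunction v) (hp : p ∈ Icc (0 : ℝ) 1) :
    M.lowerTarget v p ∈ M.targetSet v ∧ M.lowerTarget v p ≤ p :=
  (hv.isClosed_diff_grossRegion.inter isClosed_Iic).csSup_mem
    ⟨0, hv.endpoint_mem (Or.inl rfl), hp.1⟩ ⟨p, fun _ h => h.2⟩

theorem le_lowerTarget (hq : q ∈ M.targetSet v) (hqp : q ≤ p) : q ≤ M.lowerTarget v p :=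
  le_csSup ⟨p, fun _ h => h.2⟩ ⟨hq, hqp⟩

theorem upperTarget_spec (hv : M.IsValueFunction v) (hp : p ∈ Icc (0 : ℝ) 1) :
    M.upperTarget v p ∈ M.targetSet v ∧ p ≤ M.upperTarget v p :=
  (hv.isClosed_diff_grossRegion.inter isClosed_Ici).csInf_mem
    ⟨1, hv.endpoint_mem (Or.inr rfl), hp.2⟩ ⟨p, fun _ h => h.2⟩

theorem upperTarget_le (hq : q ∈ M.targetSet v) (hpq : p ≤ q) : M.upperTarget v p ≤ q :=
  csInf_le ⟨p, fun _ h => h.2⟩ ⟨hq, hpq⟩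

/-- Beliefs strictly between the targets at `p` have the same targets as `p`. -/
theorem targets_eq (hv : M.IsValueFunction v) (hp : p ∈ Icc (0 : ℝ) 1)
    (h₀ : M.lowerTarget v p < a) (h₁ : a < M.upperTarget v p) :
    M.lowerTarget v a = M.lowerTarget v p ∧ M.upperTarget v a = M.upperTarget v p := by
  obtain ⟨hl, hlp⟩ := hv.lowerTarget_spec hp
  obtain ⟨hu, hpu⟩ := hv.upperTarget_spec hp
  have ha : a ∈ Icc (0 : ℝ) 1 := ⟨hl.1.1.trans h₀.le, h₁.le.trans hu.1.2⟩
  obtain ⟨hla, hlaa⟩ := hv.lowerTarget_spec ha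
  obtain ⟨hua, haua⟩ := hv.upperTarget_spec ha
  constructor
  · refine le_antisymm ?_ (le_lowerTarget hl h₀.le)
    rcases le_total (M.lowerTarget v a) p with h | h
    · exact le_lowerTarget hla h
    · exact absurd (upperTarget_le hla h) (by linarith)
  · refine le_antisymm (upperTarget_le hu h₁.le) ?_
    rcases le_total p (M.upperTarget v a) with h | h
    · exact upperTarget_le hua h
    · exact absurd (le_lowerTarget hua h) (by linarith)

/-- The infimum is attained because the acquisition region is closed and drift is continuous in
time. -/
theorem exists_waitTime (hv : M.IsValueFunction v) (h : M.waitTime v x ≠ ∞) :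
    ∃ t, 0 ≤ t ∧ M.drift t x ∈ M.infoRegion v ∧ M.waitTime v x = ENNReal.ofReal t := by
  have hne : {t | 0 ≤ t ∧ M.drift t x ∈ M.infoRegion v}.Nonempty := by
    by_contra hemp
    refine h (waitTime_eq_top_iff.2 fun t ht hI => hemp ⟨t, ht, hI⟩)
  have hcl : IsClosed {t | 0 ≤ t ∧ M.drift t x ∈ M.infoRegion v} :=
    isClosed_Ici.inter (hv.isClosed_infoRegion.preimage (M.continuous_drift_time x))
  have hbdd : BddBelow {t | 0 ≤ t ∧ M.drift t x ∈ M.infoRegion v} := ⟨0, fun t ht => ht.1⟩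
  obtain ⟨h0, hI⟩ := hcl.csInf_mem hne hbdd
  refine ⟨_, h0, hI, le_antisymm (sInf_le ⟨_, h0, hI, rfl⟩) (le_sInf ?_)⟩
  rintro _ ⟨t, ht, htI, rfl⟩
  exact ENNReal.ofReal_le_ofReal (csInf_le hbdd ⟨ht, htI⟩)

theorem acqBelief_mem (hv : M.IsValueFunction v) (h : M.waitTime v x ≠ ∞) :
    M.acqBelief v x ∈ M.infoRegion v := by
  obtain ⟨t, ht, hI, hw⟩ := hv.exists_waitTime h
  rwa [acqBelief, hw, ENNReal.toReal_ofReal ht]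

theorem notMem_targetSet (hp : p ∈ M.infoRegion v) : p ∉ M.targetSet v := fun h =>
  h.2 ⟨hp.1, by rw [hp.2]; exact M.kappa_pos⟩

theorem posterior_mem_targetSet (hv : M.IsValueFunction v) (hp : p ∈ Icc (0 : ℝ) 1) (s : ℝ) :
    M.posterior v p s ∈ M.targetSet v := by
  rcases posterior_cases (M := M) (v := v) p s with h | h <;> rw [h]
  exacts [(hv.lowerTarget_spec hp).1, (hv.upperTarget_spec hp).1]

theorem updatedBelief_succ_mem (hv : M.IsValueFunction v) {p₀ : ℝ} {ω : ℕ → unitInterval} {n : ℕ}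
    (h : M.waitTime v (M.updatedBelief v p₀ ω n) ≠ ∞) :
    M.updatedBelief v p₀ ω (n + 1) ∈ M.targetSet v := by
  rw [updatedBelief_succ h]
  exact hv.posterior_mem_targetSet (hv.acqBelief_mem h).1 _

theorem updatedBelief_mem (hv : M.IsValueFunction v) {p₀ : ℝ} (hp₀ : p₀ ∈ Icc (0 : ℝ) 1)
    (ω : ℕ → unitInterval) (n : ℕ) : M.updatedBelief v p₀ ω n ∈ Icc (0 : ℝ) 1 := by
  induction n with
  | zero => exact hp₀
  | succ n ih =>
    by_cases h : M.waitTime v (M.updatedBelief v p₀ ω n) = ∞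
    · rwa [updatedBelief_succ_of_eq_top h]
    · exact (hv.updatedBelief_succ_mem h).1

/-- The gap `d` separates the acquisition region from the beliefs without gross value. -/
def Separated (M : LearningModel) (v : ℝ → ℝ) (d : ℝ) : Prop :=
  ∀ p ∈ M.infoRegion v, ∀ q ∈ M.targetSet v, d ≤ |p - q|

theorem lowerTarget_add_le (hv : M.IsValueFunction v) (hd : Separated M v d)
    (hp : p ∈ M.infoRegion v) : M.lowerTarget v p + d ≤ p := by
  obtain ⟨h1, h2⟩ := hv.lowerTarget_spec hp.1
  have := hd p hp _ h1
  rw [abs_of_nonneg (by linarith)] at this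
  linarith

theorem add_le_upperTarget (hv : M.IsValueFunction v) (hd : Separated M v d)
    (hp : p ∈ M.infoRegion v) : p + d ≤ M.upperTarget v p := by
  obtain ⟨h1, h2⟩ := hv.upperTarget_spec hp.1
  have := hd p hp _ h1
  rw [abs_of_nonpos (by linarith)] at this
  linarith

/-- The targets are at most 1 apart and the upper one is at least `d` away from `p`, so the lower
one has probability at least `d`, uniformly in `p`. -/
theorem posterior_eq_lowerTarget (hv : M.IsValueFunction v) (hd : Separated M v d)
    (hp : p ∈ M.infoRegion v) {s : unitInterval} (hs : (s : ℝ) < d) :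
    M.posterior v p s = M.lowerTarget v p := by
  have h1 := hv.add_le_upperTarget hd hp
  have h2 := (hv.upperTarget_spec hp.1).1.1.2
  have h3 := (hv.lowerTarget_spec hp.1).1.1.1
  unfold posterior
  rw [if_pos]
  nlinarith [s.2.1]

theorem posterior_eq_upperTarget (hv : M.IsValueFunction v) (hd0 : 0 < d) (hd : Separated M v d)
    (hp : p ∈ M.infoRegion v) {s : unitInterval} (hs : 1 - d < (s : ℝ)) :
    M.posterior v p s = M.upperTarget v p := by
  have h0 := hv.lowerTarget_add_le hd hp
  have h1 := hv.add_le_upperTarget hd hp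
  have h2 := (hv.upperTarget_spec hp.1).1.1.2
  have h3 := (hv.lowerTarget_spec hp.1).1.1.1
  unfold posterior
  rw [if_neg]
  nlinarith [s.2.2]

/-- Before `A` is reached, a draw in `E` raises the [0,1]-valued φ by `d`. A run of more than 1/d
such draws would push φ above 1, and runs of this length occur almost surely. -/
theorem ae_exists_mem {S A : Set ℝ} {φ : ℝ → ℝ} {E : Set unitInterval} {p₀ : ℝ} (hd : 0 < d)
    (hp₀ : p₀ ∈ S) (hφ : ∀ x ∈ S, φ x ∈ Icc (0 : ℝ) 1) (hE : MeasurableSet E)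
    (hE0 : volume E ≠ 0)
    (hstep : ∀ x ∈ S, x ∉ A → M.waitTime v x ≠ ∞ ∧ ∀ s : unitInterval,
      M.posterior v (M.acqBelief v x) s ∈ S ∧
        (s ∈ E → φ x + d ≤ φ (M.posterior v (M.acqBelief v x) s))) :
    ∀ᵐ ω ∂uniformDraws, ∃ n, M.acqTime v p₀ ω n ≠ ∞ ∧ M.updatedBelief v p₀ ω n ∈ A := by
  obtain ⟨N, hN⟩ := exists_nat_gt (1 / d)
  rw [div_lt_iff₀ hd] at hN
  filter_upwards [ae_frequently_pattern N (fun _ => E) (fun _ => hE) (fun _ => hE0)] with ω hω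
  obtain ⟨n, -, hn⟩ := hω 0
  by_contra! hA
  -- A path that never visits `A` at a finite acquisition time stays in `S` and acquires information
  -- forever.
  have hS : ∀ k, M.acqTime v p₀ ω k ≠ ∞ ∧ M.updatedBelief v p₀ ω k ∈ S := by
    intro k
    induction k with
    | zero => exact ⟨ENNReal.zero_ne_top, hp₀⟩
    | succ k ih =>
      obtain ⟨h1, h2⟩ := hstep _ ih.2 (hA k ih.1)
      refine ⟨?_, ?_⟩
      · rw [acqTime_succ]
        exact ENNReal.add_ne_top.2 ⟨ih.1, h1⟩
      · rw [updatedBelief_succ h1]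
        exact (h2 _).1
  have hclimb : ∀ i ≤ N, i * d ≤ φ (M.updatedBelief v p₀ ω (n + i)) := by
    intro i hi
    induction i with
    | zero => simpa using (hφ _ (hS n).2).1
    | succ i ih =>
      obtain ⟨h1, h2⟩ := hstep _ (hS (n + i)).2 (hA _ (hS (n + i)).1)
      have h3 := (h2 _).2 (hn i hi)
      rw [← add_assoc, updatedBelief_succ h1]
      push_cast
      linarith [ih (by omega)]
  linarith [hclimb N le_rfl, (hφ _ (hS (n + N)).2).2]

/-- Below the long run average drift is upward, so a jump to the upper target raises the belief by
at least the gap `d` relative to the previous update. -/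
theorem ae_exists_mem_of_le (hv : M.IsValueFunction v) {S A : Set ℝ} {p₀ : ℝ} (hp₀ : p₀ ∈ S)
    (hS : S ⊆ Icc 0 1)
    (hstep : ∀ x ∈ S, x ∉ A → x ≤ M.piBar ∧ M.waitTime v x ≠ ∞ ∧
      M.lowerTarget v (M.acqBelief v x) ∈ S ∧ M.upperTarget v (M.acqBelief v x) ∈ S) :
    ∀ᵐ ω ∂uniformDraws, ∃ n, M.acqTime v p₀ ω n ≠ ∞ ∧ M.updatedBelief v p₀ ω n ∈ A := by
  obtain ⟨d, hd0, hd1, hd⟩ := hv.exists_separation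
  refine ae_exists_mem (φ := fun x => x) (E := {s | 1 - d < (s : ℝ)}) hd0 hp₀ (fun x hx => hS hx)
    (measurableSet_lt measurable_const measurable_subtype_coe)
    (volume_unitInterval_gt_ne_zero (by linarith) (by linarith)) fun x hx hxA => ?_
  obtain ⟨hxpi, hw, hl, hu⟩ := hstep x hx hxA
  refine ⟨hw, fun s => ⟨?_, fun hs => ?_⟩⟩
  · rcases posterior_cases (M := M) (v := v) (M.acqBelief v x) s with h | h <;> rwa [h]
  · have hI := hv.acqBelief_mem hw
    rw [hv.posterior_eq_upperTarget hd0 hd hI hs]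
    have h1 : x ≤ M.acqBelief v x := M.le_drift ENNReal.toReal_nonneg hxpi
    linarith [hv.add_le_upperTarget hd hI]

theorem ae_exists_mem_of_ge (hv : M.IsValueFunction v) {S A : Set ℝ} {p₀ : ℝ} (hp₀ : p₀ ∈ S)
    (hS : S ⊆ Icc 0 1)
    (hstep : ∀ x ∈ S, x ∉ A → M.piBar ≤ x ∧ M.waitTime v x ≠ ∞ ∧
      M.lowerTarget v (M.acqBelief v x) ∈ S ∧ M.upperTarget v (M.acqBelief v x) ∈ S) :
    ∀ᵐ ω ∂uniformDraws, ∃ n, M.acqTime v p₀ ω n ≠ ∞ ∧ M.updatedBelief v p₀ ω n ∈ A := by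
  obtain ⟨d, hd0, hd1, hd⟩ := hv.exists_separation
  refine ae_exists_mem (φ := fun x => 1 - x) (E := {s | (s : ℝ) < d}) hd0 hp₀
    (fun x hx => ⟨by linarith [(hS hx).2], by linarith [(hS hx).1]⟩)
    (measurableSet_lt measurable_subtype_coe measurable_const)
    (volume_unitInterval_lt_ne_zero hd0 (by linarith)) fun x hx hxA => ?_
  obtain ⟨hxpi, hw, hl, hu⟩ := hstep x hx hxA
  refine ⟨hw, fun s => ⟨?_, fun hs => ?_⟩⟩
  · rcases posterior_cases (M := M) (v := v) (M.acqBelief v x) s with h | h <;> rwa [h]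
  · have hI := hv.acqBelief_mem hw
    rw [hv.posterior_eq_lowerTarget hd hI hs]
    have h1 : M.acqBelief v x ≤ x := M.drift_le ENNReal.toReal_nonneg hxpi
    linarith [hv.lowerTarget_add_le hd hI]

theorem ae_finitelyOften_of_le (hv : M.IsValueFunction v) {S : Set ℝ} {p₀ : ℝ} (hp₀ : p₀ ∈ S)
    (hS : S ⊆ Icc 0 1)
    (hstep : ∀ x ∈ S, M.waitTime v x ≠ ∞ → x ≤ M.piBar ∧
      M.lowerTarget v (M.acqBelief v x) ∈ S ∧ M.upperTarget v (M.acqBelief v x) ∈ S) :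
    ∀ᵐ ω ∂uniformDraws, M.FinitelyOften v p₀ ω := by
  filter_upwards [hv.ae_exists_mem_of_le (A := {x | M.waitTime v x = ∞}) hp₀ hS fun x hx hxA =>
    ⟨(hstep x hx hxA).1, hxA, (hstep x hx hxA).2⟩] with ω ⟨n, _, hn⟩
  exact finitelyOften_of_waitTime_eq_top hn

theorem ae_finitelyOften_of_ge (hv : M.IsValueFunction v) {S : Set ℝ} {p₀ : ℝ} (hp₀ : p₀ ∈ S)
    (hS : S ⊆ Icc 0 1)
    (hstep : ∀ x ∈ S, M.waitTime v x ≠ ∞ → M.piBar ≤ x ∧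
      M.lowerTarget v (M.acqBelief v x) ∈ S ∧ M.upperTarget v (M.acqBelief v x) ∈ S) :
    ∀ᵐ ω ∂uniformDraws, M.FinitelyOften v p₀ ω := by
  filter_upwards [hv.ae_exists_mem_of_ge (A := {x | M.waitTime v x = ∞}) hp₀ hS fun x hx hxA =>
    ⟨(hstep x hx hxA).1, hxA, (hstep x hx hxA).2⟩] with ω ⟨n, _, hn⟩
  exact finitelyOften_of_waitTime_eq_top hn

theorem acqBelief_le_piBar (hx : x ≤ M.piBar) : M.acqBelief v x ≤ M.piBar := M.drift_le_piBar hx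

theorem piBar_le_acqBelief (hx : M.piBar ≤ x) : M.piBar ≤ M.acqBelief v x := M.piBar_le_drift hx

theorem piBar_mem_unit (M : LearningModel) : M.piBar ∈ Icc (0 : ℝ) 1 :=
  Ioo_subset_Icc_self M.piBar_mem

/-- The long run average is itself a target, so neither drift nor updates can cross it: [0,π] and
[π,1] are invariant. -/
theorem finiteForAllPriors_of_notMem_grossRegion (hv : M.IsValueFunction v)
    (hpi : M.piBar ∉ M.grossRegion v) : M.FiniteForAllPriors v := by
  have hpiT : M.piBar ∈ M.targetSet v := ⟨piBar_mem_unit M, hpi⟩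
  obtain ⟨hpi0, hpi1⟩ := piBar_mem_unit M
  intro p₀ hp₀
  rcases le_total p₀ M.piBar with h | h
  · refine hv.ae_finitelyOften_of_le (S := Icc 0 M.piBar) ⟨hp₀.1, h⟩
      (Icc_subset_Icc_right hpi1) fun x hx hw => ⟨hx.2, ?_⟩
    have hI := hv.acqBelief_mem hw
    have hle := acqBelief_le_piBar (v := v) hx.2
    obtain ⟨hl, hl'⟩ := hv.lowerTarget_spec hI.1
    exact ⟨⟨hl.1.1, hl'.trans hle⟩, ⟨(hv.upperTarget_spec hI.1).1.1.1, upperTarget_le hpiT hle⟩⟩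
  · refine hv.ae_finitelyOften_of_ge (S := Icc M.piBar 1) ⟨h, hp₀.2⟩
      (Icc_subset_Icc_left hpi0) fun x hx hw => ⟨hx.1, ?_⟩
    have hI := hv.acqBelief_mem hw
    have hle := piBar_le_acqBelief (v := v) hx.1
    obtain ⟨hu, hu'⟩ := hv.upperTarget_spec hI.1
    exact ⟨⟨le_lowerTarget hpiT hle, (hv.lowerTarget_spec hI.1).1.1.2⟩, ⟨hle.trans hu', hu.1.2⟩⟩

/-- If there is no acquisition between the lower target at the long run average and the long run
average, then learning ends for all priors. -/
theorem finiteForAllPriors_of_left (hv : M.IsValueFunction v) (hpi : M.piBar ∉ M.infoRegion v)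
    (h : ∀ a ∈ M.infoRegion v, a < M.piBar → a ≤ M.lowerTarget v M.piBar) :
    M.FiniteForAllPriors v := by
  obtain ⟨hpi0, hpi1⟩ := piBar_mem_unit M
  obtain ⟨hq, hqpi⟩ := hv.lowerTarget_spec (piBar_mem_unit M)
  have h' : ∀ a ∈ M.infoRegion v, a ≤ M.piBar → a ≤ M.lowerTarget v M.piBar := fun a ha hle =>
    h a ha (lt_of_le_of_ne hle fun e => hpi (e ▸ ha))
  intro p₀ hp₀
  rcases le_total p₀ M.piBar with hp | hp
  · refine hv.ae_finitelyOften_of_le (S := Icc 0 M.piBar) ⟨hp₀.1, hp⟩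
      (Icc_subset_Icc_right hpi1) fun x hx hw => ⟨hx.2, ?_⟩
    have hI := hv.acqBelief_mem hw
    have hle := acqBelief_le_piBar (v := v) hx.2
    obtain ⟨hl, hl'⟩ := hv.lowerTarget_spec hI.1
    exact ⟨⟨hl.1.1, hl'.trans hle⟩,
      ⟨(hv.upperTarget_spec hI.1).1.1.1, (upperTarget_le hq (h' _ hI hle)).trans hqpi⟩⟩
  -- From above, a jump can cross the long run average only to its lower target, which is therefore
  -- added to the invariant set.
  · refine hv.ae_finitelyOften_of_ge
      (S := {x | x ∈ Icc (0 : ℝ) 1 ∧ (M.piBar ≤ x ∨ x = M.lowerTarget v M.piBar)})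
      ⟨hp₀, Or.inl hp⟩ (fun x hx => hx.1) fun x hx hw => ?_
    have hI := hv.acqBelief_mem hw
    have hxpi : M.piBar ≤ x := by
      rcases hx.2 with hx2 | rfl
      · exact hx2
      · exfalso
        -- An acquisition from the lower target would take place at a belief between it and the long
        -- run average, hence by hypothesis at the target itself, which has no gross value.
        have h1 := h' _ hI (acqBelief_le_piBar hqpi)
        have h2 : M.lowerTarget v M.piBar ≤ M.acqBelief v (M.lowerTarget v M.piBar) :=
          M.le_drift ENNReal.toReal_nonneg hqpi
        exact notMem_targetSet hI ((le_antisymm h1 h2).symm ▸ hq)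
    have hle := piBar_le_acqBelief (v := v) hxpi
    obtain ⟨hl, hl'⟩ := hv.lowerTarget_spec hI.1
    obtain ⟨hu, hu'⟩ := hv.upperTarget_spec hI.1
    refine ⟨hxpi, ⟨hl.1, ?_⟩, ⟨hu.1, Or.inl (hle.trans hu')⟩⟩
    rcases le_total M.piBar (M.lowerTarget v (M.acqBelief v x)) with h1 | h1
    · exact Or.inl h1
    · exact Or.inr (le_antisymm (le_lowerTarget hl h1) (le_lowerTarget hq (hqpi.trans hle)))

/-- Mirror image of `finiteForAllPriors_of_left`. -/
theorem finiteForAllPriors_of_right (hv : M.IsValueFunction v) (hpi : M.piBar ∉ M.infoRegion v)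
    (h : ∀ a ∈ M.infoRegion v, M.piBar < a → M.upperTarget v M.piBar ≤ a) :
    M.FiniteForAllPriors v := by
  obtain ⟨hpi0, hpi1⟩ := piBar_mem_unit M
  obtain ⟨hq, hqpi⟩ := hv.upperTarget_spec (piBar_mem_unit M)
  have h' : ∀ a ∈ M.infoRegion v, M.piBar ≤ a → M.upperTarget v M.piBar ≤ a := fun a ha hle =>
    h a ha (lt_of_le_of_ne hle fun e => hpi (e ▸ ha))
  intro p₀ hp₀
  rcases le_total M.piBar p₀ with hp | hp
  · refine hv.ae_finitelyOften_of_ge (S := Icc M.piBar 1) ⟨hp, hp₀.2⟩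
      (Icc_subset_Icc_left hpi0) fun x hx hw => ⟨hx.1, ?_⟩
    have hI := hv.acqBelief_mem hw
    have hle := piBar_le_acqBelief (v := v) hx.1
    obtain ⟨hu, hu'⟩ := hv.upperTarget_spec hI.1
    exact ⟨⟨hqpi.trans (le_lowerTarget hq (h' _ hI hle)), (hv.lowerTarget_spec hI.1).1.1.2⟩,
      ⟨hle.trans hu', hu.1.2⟩⟩
  · refine hv.ae_finitelyOften_of_le
      (S := {x | x ∈ Icc (0 : ℝ) 1 ∧ (x ≤ M.piBar ∨ x = M.upperTarget v M.piBar)})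
      ⟨hp₀, Or.inl hp⟩ (fun x hx => hx.1) fun x hx hw => ?_
    have hI := hv.acqBelief_mem hw
    have hxpi : x ≤ M.piBar := by
      rcases hx.2 with hx2 | rfl
      · exact hx2
      · exfalso
        have h1 := h' _ hI (piBar_le_acqBelief hqpi)
        have h2 : M.acqBelief v (M.upperTarget v M.piBar) ≤ M.upperTarget v M.piBar :=
          M.drift_le ENNReal.toReal_nonneg hqpi
        exact notMem_targetSet hI ((le_antisymm h1 h2) ▸ hq)
    have hle := acqBelief_le_piBar (v := v) hxpi
    obtain ⟨hl, hl'⟩ := hv.lowerTarget_spec hI.1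
    obtain ⟨hu, hu'⟩ := hv.upperTarget_spec hI.1
    refine ⟨hxpi, ⟨hl.1, Or.inl (hl'.trans hle)⟩, ⟨hu.1, ?_⟩⟩
    rcases le_total (M.upperTarget v (M.acqBelief v x)) M.piBar with h1 | h1
    · exact Or.inl h1
    · exact Or.inr (le_antisymm (upperTarget_le hq (hle.trans hqpi)) (upperTarget_le hu h1))

/-- Infinitely many acquisitions within a finite time are impossible: each update is at least `d`
away from the acquisition region, and drift covers that distance in no less than d/λ. -/
theorem exists_waitTime_eq_top (hv : M.IsValueFunction v) {p₀ : ℝ} {ω : ℕ → unitInterval}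
    (h : M.LearningStops v p₀ ω) : ∃ n, M.waitTime v (M.updatedBelief v p₀ ω n) = ∞ := by
  obtain ⟨d, hd0, -, hd⟩ := hv.exists_separation
  obtain ⟨T, hT⟩ := h
  have hlam := M.lam_pos
  by_contra! hw
  -- The bound starts at the first update because the prior need not be a target and may itself lie
  -- in the acquisition region.
  have hwait : ∀ n, ENNReal.ofReal (d / M.lam) ≤
      M.waitTime v (M.updatedBelief v p₀ ω (n + 1)) := by
    intro n
    have hmem := hv.updatedBelief_succ_mem (hw n)
    obtain ⟨t, ht, hI, hwt⟩ := hv.exists_waitTime (hw (n + 1))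
    rw [hwt]
    refine ENNReal.ofReal_le_ofReal ?_
    rw [div_le_iff₀' hlam]
    exact (hd _ hI _ hmem).trans (M.abs_drift_sub_le ht hmem.1)
  have hfin : ∀ n, M.acqTime v p₀ ω n ≠ ∞ := by
    intro n
    induction n with
    | zero => exact ENNReal.zero_ne_top
    | succ n ih => rw [acqTime_succ]; exact ENNReal.add_ne_top.2 ⟨ih, hw n⟩
  have hlow : ∀ n : ℕ, ENNReal.ofReal (n * (d / M.lam)) ≤ M.acqTime v p₀ ω (n + 1) := by
    intro n
    induction n with
    | zero => simp
    | succ n ih =>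
      rw [acqTime_succ]
      refine le_trans (le_of_eq ?_) (add_le_add ih (hwait n))
      rw [← ENNReal.ofReal_add (by positivity) (by positivity)]
      push_cast
      ring_nf
  obtain ⟨n, hn⟩ := exists_nat_gt (T / (d / M.lam))
  rw [div_lt_iff₀ (by positivity)] at hn
  have h1 := (hlow n).trans ((hT (n + 1) (by omega)).resolve_right (hfin _))
  rw [← ENNReal.ofReal_coe_nnreal] at h1
  have h2 := (ENNReal.ofReal_le_ofReal_iff T.2).1 h1
  exact absurd hn (not_lt.2 h2)

end IsValueFunction
end LearningModel

end

/-! ### Belief cycles and traps -/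

noncomputable section

namespace LearningModel

variable {M : LearningModel} {v : ℝ → ℝ}

/-- There are acquisition beliefs on both sides of the long run average with the same targets. -/
def SurroundedByAcquisition (M : LearningModel) (v : ℝ → ℝ) : Prop :=
  ∃ a ∈ M.infoRegion v, ∃ b ∈ M.infoRegion v, a < M.piBar ∧ M.piBar < b ∧
    M.lowerTarget v a = M.lowerTarget v M.piBar ∧ M.upperTarget v a = M.upperTarget v M.piBar ∧
    M.lowerTarget v b = M.lowerTarget v M.piBar ∧ M.upperTarget v b = M.upperTarget v M.piBar

namespace IsValueFunction

theorem lowerTarget_lt (hv : M.IsValueFunction v) {p : ℝ} (hp : p ∈ M.infoRegion v) :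
    M.lowerTarget v p < p := by
  obtain ⟨h1, h2⟩ := hv.lowerTarget_spec hp.1
  exact lt_of_le_of_ne h2 fun h => notMem_targetSet hp (h ▸ h1)

theorem lt_upperTarget (hv : M.IsValueFunction v) {p : ℝ} (hp : p ∈ M.infoRegion v) :
    p < M.upperTarget v p := by
  obtain ⟨h1, h2⟩ := hv.upperTarget_spec hp.1
  exact lt_of_le_of_ne h2 fun h => notMem_targetSet hp (h.symm ▸ h1)

/-- If neither one-sided criterion applies, there are acquisition beliefs on both sides of π
strictly between its targets, and these share its targets. -/
theorem finiteForAllPriors_of_not_surrounded (hv : M.IsValueFunction v)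
    (hpi : M.piBar ∉ M.infoRegion v) (h : ¬ M.SurroundedByAcquisition v) :
    M.FiniteForAllPriors v := by
  have hq0 := (hv.lowerTarget_spec (piBar_mem_unit M)).2
  have hq1 := (hv.upperTarget_spec (piBar_mem_unit M)).2
  by_cases h0 : ∀ a ∈ M.infoRegion v, a < M.piBar → a ≤ M.lowerTarget v M.piBar
  · exact hv.finiteForAllPriors_of_left hpi h0
  by_cases h1 : ∀ a ∈ M.infoRegion v, M.piBar < a → M.upperTarget v M.piBar ≤ a
  · exact hv.finiteForAllPriors_of_right hpi h1
  push Not at h0 h1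
  obtain ⟨a, ha, hapi, ha'⟩ := h0
  obtain ⟨b, hb, hbpi, hb'⟩ := h1
  obtain ⟨e1, e2⟩ := hv.targets_eq (piBar_mem_unit M) ha' (hapi.trans_le hq1)
  obtain ⟨e3, e4⟩ := hv.targets_eq (piBar_mem_unit M) (hq0.trans_lt hbpi) hb'
  exact absurd ⟨a, ha, b, hb, hapi, hbpi, e1, e2, e3, e4⟩ h

theorem acqTime_add_ne_top {p₀ : ℝ} {ω : ℕ → unitInterval} {B : M.BeliefCycle} {N : ℕ}
    (h0 : M.acqTime v p₀ ω N ≠ ∞)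
    (h : ∀ n, N ≤ n →
      (M.updatedBelief v p₀ ω n = B.q₀ ∧
        M.acqTime v p₀ ω (n + 1) = M.acqTime v p₀ ω n + ENNReal.ofReal B.τ₀) ∨
      (M.updatedBelief v p₀ ω n = B.q₁ ∧
        M.acqTime v p₀ ω (n + 1) = M.acqTime v p₀ ω n + ENNReal.ofReal B.τ₁))
    {n : ℕ} (hn : N ≤ n) : M.acqTime v p₀ ω n ≠ ∞ := by
  induction n, hn using Nat.le_induction with
  | base => exact h0
  | succ k hk ih =>
    rcases h k hk with h' | h' <;> rw [h'.2] <;>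
      exact ENNReal.add_ne_top.2 ⟨ih, ENNReal.ofReal_ne_top⟩

theorem not_finitelyOften_of_eventuallyFollows {p₀ : ℝ} {ω : ℕ → unitInterval}
    {B : M.BeliefCycle} (h : M.EventuallyFollows v p₀ ω B) : ¬ M.FinitelyOften v p₀ ω := by
  obtain ⟨N, h0, h⟩ := h
  intro hfin
  refine (Set.Ici_infinite (N + 1)) (hfin.subset fun n hn => ⟨?_, ?_⟩)
  · exact (Nat.le_add_left 1 N).trans hn
  · exact acqTime_add_ne_top h0 h ((Nat.le_succ N).trans hn)

/-- The prior 0 lies outside every candidate trap, so a trap always supplies at least one belief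
cycle. -/
theorem zero_mem_diff_Ioo {a b : ℝ} (ha : 0 ≤ a) : (0 : ℝ) ∈ Icc (0 : ℝ) 1 \ Ioo a b :=
  ⟨by simp, fun h => absurd h.1 (not_lt.2 ha)⟩

theorem not_finiteForAllPriors_and_hasTrap : ¬ (M.FiniteForAllPriors v ∧ M.HasTrap v) := by
  rintro ⟨hfin, a, b, ha, -, -, -, -, hcyc⟩
  obtain ⟨B, hB⟩ := hcyc 0 (zero_mem_diff_Ioo ha)
  obtain ⟨ω, h1, h2⟩ := ((hfin 0 (by simp)).and hB).exists
  exact not_finitelyOften_of_eventuallyFollows h2 h1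

theorem surrounded_of_hasTrap (hv : M.IsValueFunction v) (h : M.HasTrap v) :
    M.SurroundedByAcquisition v := by
  obtain ⟨d, hd0, hd1, hd⟩ := hv.exists_separation
  obtain ⟨a, b, ha, -, -, -, -, hcyc⟩ := h
  obtain ⟨B, hB⟩ := hcyc 0 (zero_mem_diff_Ioo ha)
  -- A low draw followed by a high draw, after the path has joined the cycle, displays the lower
  -- target and then the upper one.
  have hpat := ae_frequently_pattern 2
    (fun i => if i = 0 then {s : unitInterval | (s : ℝ) < d} else {s | 1 - d < (s : ℝ)})
    (fun i => by
      split_ifs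
      · exact measurableSet_lt measurable_subtype_coe measurable_const
      · exact measurableSet_lt measurable_const measurable_subtype_coe)
    (fun i => by
      split_ifs
      · exact volume_unitInterval_lt_ne_zero hd0 (by linarith)
      · exact volume_unitInterval_gt_ne_zero (by linarith) (by linarith))
  obtain ⟨ω, ⟨N, h0, hfol⟩, hω⟩ := (hB.and hpat).exists
  obtain ⟨n, hn, hdraw⟩ := hω N
  have hd₀ : (ω n : ℝ) < d := by simpa using hdraw 0 (by norm_num)
  have hd₁ : 1 - d < (ω (n + 1) : ℝ) := by simpa using hdraw 1 (by norm_num)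
  have hlt₀ := B.q₀_lt
  have hlt₁ := B.p₀_lt
  have hlt₂ := B.lt_p₁
  have hlt₃ := B.lt_q₁
  have hval : ∀ m, N ≤ m → M.updatedBelief v 0 ω m = B.q₀ ∨ M.updatedBelief v 0 ω m = B.q₁ :=
    fun m hm => (hfol m hm).imp And.left And.left
  -- an update at time `m` takes place at a threshold belief
  have hstep : ∀ m, N ≤ m → M.waitTime v (M.updatedBelief v 0 ω m) ≠ ∞ ∧
      ((M.updatedBelief v 0 ω m = B.q₀ ∧ M.acqBelief v (M.updatedBelief v 0 ω m) = B.p₀) ∨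
      (M.updatedBelief v 0 ω m = B.q₁ ∧ M.acqBelief v (M.updatedBelief v 0 ω m) = B.p₁)) := by
    intro m hm
    have hne := acqTime_add_ne_top h0 hfol hm
    rcases hfol m hm with ⟨h1, h2⟩ | ⟨h1, h2⟩ <;>
      rw [acqTime_succ, ENNReal.add_right_inj hne] at h2
    · refine ⟨by rw [h2]; exact ENNReal.ofReal_ne_top, Or.inl ⟨h1, ?_⟩⟩
      rw [acqBelief, h2, ENNReal.toReal_ofReal B.τ₀_pos.le, h1, B.drift₀]
    · refine ⟨by rw [h2]; exact ENNReal.ofReal_ne_top, Or.inr ⟨h1, ?_⟩⟩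
      rw [acqBelief, h2, ENNReal.toReal_ofReal B.τ₁_pos.le, h1, B.drift₁]
  -- The low draw leads strictly below a threshold, and both thresholds lie below `B.q₁`.
  have hx₁ : M.updatedBelief v 0 ω (n + 1) = B.q₀ := by
    obtain ⟨hw, hp⟩ := hstep n hn
    have hI := hv.acqBelief_mem hw
    have hlow := hv.lowerTarget_lt hI
    have hup : M.updatedBelief v 0 ω (n + 1) = M.lowerTarget v _ :=
      (updatedBelief_succ hw).trans (hv.posterior_eq_lowerTarget hd hI hd₀)
    rcases hval (n + 1) (by omega) with h | h
    · exact h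
    · exfalso
      rw [hup] at h
      rcases hp with ⟨-, hp⟩ | ⟨-, hp⟩ <;> rw [hp] at hlow h <;> linarith
  obtain ⟨hw, hp⟩ := hstep (n + 1) (by omega)
  have hI₀ := hv.acqBelief_mem hw
  have hp₀ : M.acqBelief v (M.updatedBelief v 0 ω (n + 1)) = B.p₀ := by
    rcases hp with ⟨-, hp⟩ | ⟨hp, -⟩
    · exact hp
    · linarith
  rw [hp₀] at hI₀
  have hx₂ : M.updatedBelief v 0 ω (n + 1 + 1) = M.upperTarget v B.p₀ := by
    rw [updatedBelief_succ hw, hp₀, hv.posterior_eq_upperTarget hd0 hd hI₀ hd₁]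
  have hu := hv.lt_upperTarget hI₀
  have hq₁ : M.upperTarget v B.p₀ = B.q₁ := by
    rcases hval (n + 1 + 1) (by omega) with h | h <;> rw [hx₂] at h
    · linarith
    · exact h
  obtain ⟨hw', hp'⟩ := hstep (n + 1 + 1) (by omega)
  have hI₁ := hv.acqBelief_mem hw'
  have hp₁ : M.acqBelief v (M.updatedBelief v 0 ω (n + 1 + 1)) = B.p₁ := by
    rcases hp' with ⟨hp', -⟩ | ⟨-, hp'⟩
    · linarith
    · exact hp'
  rw [hp₁] at hI₁
  have hl := hv.lowerTarget_lt hI₀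
  -- The upper target at `B.p₀` is `B.q₁`, so both π and `B.p₁` lie strictly between the targets at
  -- `B.p₀` and share them.
  obtain ⟨e1, e2⟩ := hv.targets_eq (a := M.piBar) hI₀.1 (by linarith) (by linarith)
  obtain ⟨e3, e4⟩ := hv.targets_eq (a := B.p₁) hI₀.1 (by linarith) (by linarith)
  exact ⟨B.p₀, hI₀, B.p₁, hI₁, hlt₁, hlt₂, e1.symm, e2.symm, e3.trans e1.symm, e4.trans e2.symm⟩

/-- Beliefs that reach one of the targets of a belief cycle follow the cycle from then on. -/
theorem eventuallyFollows_of_mem (B : M.BeliefCycle)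
    (hw₀ : M.waitTime v B.q₀ = ENNReal.ofReal B.τ₀) (hw₁ : M.waitTime v B.q₁ = ENNReal.ofReal B.τ₁)
    (hl₀ : M.lowerTarget v B.p₀ = B.q₀) (hu₀ : M.upperTarget v B.p₀ = B.q₁)
    (hl₁ : M.lowerTarget v B.p₁ = B.q₀) (hu₁ : M.upperTarget v B.p₁ = B.q₁)
    {p₀ : ℝ} {ω : ℕ → unitInterval} {n : ℕ} (hn : M.acqTime v p₀ ω n ≠ ∞)
    (hmem : M.updatedBelief v p₀ ω n = B.q₀ ∨ M.updatedBelief v p₀ ω n = B.q₁) :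
    M.EventuallyFollows v p₀ ω B := by
  have hp₀ : M.acqBelief v B.q₀ = B.p₀ := by
    rw [acqBelief, hw₀, ENNReal.toReal_ofReal B.τ₀_pos.le, B.drift₀]
  have hp₁ : M.acqBelief v B.q₁ = B.p₁ := by
    rw [acqBelief, hw₁, ENNReal.toReal_ofReal B.τ₁_pos.le, B.drift₁]
  have hall : ∀ m, n ≤ m →
      M.updatedBelief v p₀ ω m = B.q₀ ∨ M.updatedBelief v p₀ ω m = B.q₁ := by
    intro m hm
    induction m, hm using Nat.le_induction with
    | base => exact hmem
    | succ k _ ih =>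
      rcases ih with h | h
      · rw [updatedBelief_succ (by rw [h, hw₀]; exact ENNReal.ofReal_ne_top), h, hp₀]
        exact posterior_cases _ _ |>.imp (fun e => by rw [e, hl₀]) (fun e => by rw [e, hu₀])
      · rw [updatedBelief_succ (by rw [h, hw₁]; exact ENNReal.ofReal_ne_top), h, hp₁]
        exact posterior_cases _ _ |>.imp (fun e => by rw [e, hl₁]) (fun e => by rw [e, hu₁])
  refine ⟨n, hn, fun m hm => ?_⟩
  refine (hall m hm).imp (fun h => ⟨h, ?_⟩) (fun h => ⟨h, ?_⟩)
  · rw [acqTime_succ, h, hw₀]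
  · rw [acqTime_succ, h, hw₁]

/-- The trap is bounded by the acquisition beliefs `l` and `u` closest to π. Drift from outside must
pass one of them, while drift from inside moves towards π and meets no acquisition belief. -/
theorem hasTrap_of_surrounded (hv : M.IsValueFunction v) (hpi : M.piBar ∉ M.infoRegion v)
    (h : M.SurroundedByAcquisition v) : M.HasTrap v := by
  obtain ⟨a, ha, b, hb, hapi, hbpi, hla, -, -, hub⟩ := h
  have hpiI := piBar_mem_unit M
  obtain ⟨hq₀, hq₀pi⟩ := hv.lowerTarget_spec hpiI
  obtain ⟨hq₁, hq₁pi⟩ := hv.upperTarget_spec hpiI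
  have ha' := hv.lowerTarget_lt ha
  have hb' := hv.lt_upperTarget hb
  rw [hla] at ha'
  rw [hub] at hb'
  set q₀ := M.lowerTarget v M.piBar with hq₀_def
  set q₁ := M.upperTarget v M.piBar with hq₁_def
  -- the acquisition beliefs closest to the long run average
  obtain ⟨l, hl, hlpi, hmax⟩ : ∃ l ∈ M.infoRegion v, l < M.piBar ∧
      ∀ x ∈ M.infoRegion v, x ≤ M.piBar → x ≤ l := by
    have hbdd : BddAbove (M.infoRegion v ∩ Iic M.piBar) := ⟨_, fun _ h => h.2⟩
    have hm := (hv.isClosed_infoRegion.inter isClosed_Iic).csSup_mem ⟨a, ha, hapi.le⟩ hbdd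
    exact ⟨_, hm.1, lt_of_le_of_ne hm.2 fun e => hpi (e ▸ hm.1),
      fun x hx hxpi => le_csSup hbdd ⟨hx, hxpi⟩⟩
  obtain ⟨u, hu, hupi, hmin⟩ : ∃ u ∈ M.infoRegion v, M.piBar < u ∧
      ∀ x ∈ M.infoRegion v, M.piBar ≤ x → u ≤ x := by
    have hbdd : BddBelow (M.infoRegion v ∩ Ici M.piBar) := ⟨_, fun _ h => h.2⟩
    have hm := (hv.isClosed_infoRegion.inter isClosed_Ici).csInf_mem ⟨b, hb, hbpi.le⟩ hbdd
    exact ⟨_, hm.1, lt_of_le_of_ne hm.2 fun e => hpi (e ▸ hm.1),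
      fun x hx hxpi => csInf_le hbdd ⟨hx, hxpi⟩⟩
  have hal := hmax a ha hapi.le
  have hbu := hmin b hb hbpi.le
  have hwl : ∀ x ≤ l, M.waitTime v x ≠ ∞ := fun x hx => by
    obtain ⟨t, ht, hdt⟩ := M.exists_drift_eq_of_le hx hlpi
    exact waitTime_ne_top ht (hdt.symm ▸ hl)
  have hwu : ∀ x, u ≤ x → M.waitTime v x ≠ ∞ := fun x hx => by
    obtain ⟨t, ht, hdt⟩ := M.exists_drift_eq_of_ge hx hupi
    exact waitTime_ne_top ht (hdt.symm ▸ hu)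
  obtain ⟨t₀, ht₀, hI₀, hw₀⟩ := hv.exists_waitTime (hwl q₀ (by linarith))
  obtain ⟨t₁, ht₁, hI₁, hw₁⟩ := hv.exists_waitTime (hwu q₁ (by linarith))
  have hne₀ : M.drift t₀ q₀ ≠ q₀ := fun e => notMem_targetSet (e ▸ hI₀) hq₀
  have hne₁ : M.drift t₁ q₁ ≠ q₁ := fun e => notMem_targetSet (e ▸ hI₁) hq₁
  have hlt₀ : q₀ < M.drift t₀ q₀ := lt_of_le_of_ne (M.le_drift ht₀ hq₀pi) hne₀.symm
  have hlt₁ : M.drift t₁ q₁ < q₁ := lt_of_le_of_ne (M.drift_le ht₁ hq₁pi) hne₁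
  have hp₀pi : M.drift t₀ q₀ < M.piBar := M.drift_lt_piBar (by linarith)
  have hp₁pi : M.piBar < M.drift t₁ q₁ := M.piBar_lt_drift (by linarith)
  let B : M.BeliefCycle :=
    { q₀ := q₀, q₁ := q₁, p₀ := M.drift t₀ q₀, p₁ := M.drift t₁ q₁, τ₀ := t₀, τ₁ := t₁
      q₀_nonneg := hq₀.1.1
      q₀_lt := hlt₀
      p₀_lt := hp₀pi
      lt_p₁ := hp₁pi
      lt_q₁ := hlt₁
      q₁_le_one := hq₁.1.2
      τ₀_pos := lt_of_le_of_ne ht₀ fun e => hne₀ (by rw [← e, drift_zero])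
      τ₁_pos := lt_of_le_of_ne ht₁ fun e => hne₁ (by rw [← e, drift_zero])
      drift₀ := rfl
      drift₁ := rfl }
  obtain ⟨e1, e2⟩ := hv.targets_eq (a := M.drift t₀ q₀) hpiI hlt₀ (by linarith)
  obtain ⟨e3, e4⟩ := hv.targets_eq (a := M.drift t₁ q₁) hpiI (by linarith) hlt₁
  have hfollow {p : ℝ} {ω : ℕ → unitInterval} {n : ℕ} (hn : M.acqTime v p ω n ≠ ∞)
      (hmem : M.updatedBelief v p ω n ∈ ({q₀, q₁} : Set ℝ)) : M.EventuallyFollows v p ω B :=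
    eventuallyFollows_of_mem B hw₀ hw₁ e1 e2 e3 e4 hn hmem
  refine ⟨l, u, hl.1.1, hlpi, hupi, hu.1.2, fun p hp => ?_, fun p hp => ⟨B, ?_⟩⟩
  · refine Filter.Eventually.of_forall fun ω n hn => ?_
    refine acqTime_eq_top (n := 0) (waitTime_eq_top_iff.2 fun t ht hI => ?_) hn
    change M.drift t p ∈ _ at hI
    rcases le_total p M.piBar with h | h
    · exact absurd (hp.1.trans_le (M.le_drift ht h)) (not_lt.2 (hmax _ hI (M.drift_le_piBar h)))
    · exact absurd ((M.drift_le ht h).trans_lt hp.2) (not_lt.2 (hmin _ hI (M.piBar_le_drift h)))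
  rcases le_or_gt p l with h | h
  · have hreach := hv.ae_exists_mem_of_le (p₀ := p) (A := {q₀, q₁})
      (S := {x | x ∈ Icc (0 : ℝ) 1 ∧ (x ≤ l ∨ x ∈ ({q₀, q₁} : Set ℝ))})
      ⟨hp.1, Or.inl h⟩ (fun x hx => hx.1) fun x hx hxA => ?_
    · filter_upwards [hreach] with ω ⟨n, hn, hmem⟩ using hfollow hn hmem
    · have hxl : x ≤ l := hx.2.resolve_right hxA
      have hI := hv.acqBelief_mem (hwl x hxl)
      have hle := hmax _ hI (acqBelief_le_piBar (hxl.trans hlpi.le))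
      obtain ⟨hlT, hlT'⟩ := hv.lowerTarget_spec hI.1
      refine ⟨hxl.trans hlpi.le, hwl x hxl, ⟨hlT.1, Or.inl (hlT'.trans hle)⟩,
        (hv.upperTarget_spec hI.1).1.1, ?_⟩
      -- An acquisition at or below `q₀` cannot jump past `q₀`, which is below `l`; one between `q₀`
      -- and `l` has the targets of π, so its upper target is `q₁`.
      rcases le_or_gt (M.acqBelief v x) q₀ with h1 | h1
      · exact Or.inl ((upperTarget_le hq₀ h1).trans (by linarith))
      · exact Or.inr (Or.inr (hv.targets_eq hpiI h1 (by linarith)).2)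
  · have h' : u ≤ p := not_lt.1 fun hlt => hp.2 ⟨h, hlt⟩
    have hreach := hv.ae_exists_mem_of_ge (p₀ := p) (A := {q₀, q₁})
      (S := {x | x ∈ Icc (0 : ℝ) 1 ∧ (u ≤ x ∨ x ∈ ({q₀, q₁} : Set ℝ))})
      ⟨hp.1, Or.inl h'⟩ (fun x hx => hx.1) fun x hx hxA => ?_
    · filter_upwards [hreach] with ω ⟨n, hn, hmem⟩ using hfollow hn hmem
    · have hxu : u ≤ x := hx.2.resolve_right hxA
      have hI := hv.acqBelief_mem (hwu x hxu)
      have hle := hmin _ hI (piBar_le_acqBelief (hupi.le.trans hxu))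
      obtain ⟨huT, huT'⟩ := hv.upperTarget_spec hI.1
      refine ⟨hupi.le.trans hxu, hwu x hxu, ⟨(hv.lowerTarget_spec hI.1).1.1, ?_⟩,
        huT.1, Or.inl (hle.trans huT')⟩
      rcases le_or_gt q₁ (M.acqBelief v x) with h1 | h1
      · exact Or.inl (le_trans (by linarith) (le_lowerTarget hq₁ h1))
      · exact Or.inr (Or.inl (hv.targets_eq hpiI (by linarith) h1).1)

end IsValueFunction
end LearningModel

end

theorem mainTheorem6 (M : LearningModel) (v : ℝ → ℝ) (hv : M.IsValueFunction v) :
    -- (i), up to a tie at the long run average between acquiring at once and never acquiring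
    (∀ p₀ ∈ Icc (0 : ℝ) 1, (∃ᵐ ω ∂uniformDraws, M.LearningStops v p₀ ω) →
      M.piBar ∉ M.infoRegion v ∨ v M.piBar = M.lowerValue M.piBar) ∧
    -- (ii)
    (M.piBar ∉ M.grossRegion v → M.FiniteForAllPriors v) ∧
    -- (iii), with the characterization of the trap case
    (M.piBar ∈ M.grossRegion v \ M.infoRegion v →
      ((M.FiniteForAllPriors v ∨ M.HasTrap v) ∧ ¬ (M.FiniteForAllPriors v ∧ M.HasTrap v)) ∧
      (M.HasTrap v ↔
        ∃ a ∈ M.infoRegion v, ∃ b ∈ M.infoRegion v, a < M.piBar ∧ M.piBar < b ∧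
          M.lowerTarget v a = M.lowerTarget v M.piBar ∧
          M.upperTarget v a = M.upperTarget v M.piBar ∧
          M.lowerTarget v b = M.lowerTarget v M.piBar ∧
          M.upperTarget v b = M.upperTarget v M.piBar)) := by
  -- The second alternative in (i) always holds: stopping with positive probability alone makes
  -- never acquiring optimal at π.
  refine ⟨fun p₀ hp₀ h => Or.inr ?_, hv.finiteForAllPriors_of_notMem_grossRegion,
    fun hpi => ⟨⟨?_, LearningModel.IsValueFunction.not_finiteForAllPriors_and_hasTrap⟩,
      hv.surrounded_of_hasTrap, hv.hasTrap_of_surrounded hpi.2⟩⟩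
  · obtain ⟨ω, hω⟩ := h.exists
    obtain ⟨n, hn⟩ := hv.exists_waitTime_eq_top hω
    exact hv.piBar_eq_lowerValue (hv.updatedBelief_mem hp₀ ω n)
      (LearningModel.waitTime_eq_top_iff.1 hn)
  · by_cases h : M.SurroundedByAcquisition v
    · exact Or.inr (hv.hasTrap_of_surrounded hpi.2 h)
    · exact Or.inl (hv.finiteForAllPriors_of_not_surrounded hpi.2 h)
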